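/- **Setting.** Let $\boldsymbol B$ be a smooth magnetic field on $\mathbb R^3$ and consider, for $\epsilon\neq0$, the Lorentz force equations $\dot{\boldsymbol x}=\boldsymbol v$, $\dot{\boldsymbol v}=\epsilon^{-1}\boldsymbol v\times\boldsymbol B(\boldsymbol x)$. Let $(\zeta,\boldsymbol\xi)$, with $\zeta$ an angle (mod $2\pi$) and $\boldsymbol\xi$ in an open set $D\subset\mathbb R^5$, be smooth coordinates on an open part of phase space in which these equations read $$\dot\zeta=\tfrac1\epsilon\Omega_{-1}(\boldsymbol\xi)+\Omega_0(\zeta,\boldsymbol\xi),\qquad \dot{\boldsymbol\xi}=\boldsymbol U_0(\zeta,\boldsymbol\xi),$$ with $\Omega_{-1}$ nowhere zero and all functions smooth and $2\pi$-periodic in $\zeta$. Let $\Phi_\epsilon=\mathrm{id}+\epsilon\Phi_1+\epsilon^2\Phi_2+\cdots:(\zeta,\boldsymbol\xi)\mapsto(\underline\zeta,\underline{\boldsymbol\xi})$ be a formal change of coordinates, with smooth $\Phi_k$ that are $2\pi$-periodic in $\zeta$, that decouples the angle to all orders, i.e. formally $\dot{\underline\zeta}=\epsilon^{-1}\Omega_{-1}(\underline{\boldsymbol\xi})+\overline\Omega_\epsilon(\underline{\boldsymbol\xi})$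 and $\dot{\underline{\boldsymbol\xi}}=\overline U_\epsilon(\underline{\boldsymbol\xi})$, where $\overline\Omega_\epsilon,\overline U_\epsilon$ are formal power series in $\epsilon$ with smooth coefficients. Write $\fint=(2\pi)^{-1}\int_0^{2\pi}$. The loop space dynamics of a vector field $X$ with frequency functional $\Omega$ is $\partial_t\widetilde z+\Omega(\widetilde z)\,\partial_\theta\widetilde z=X(\widetilde z)$, $\dot S=\Omega(\widetilde z)$, for smooth loops $\widetilde z$. Take the loop space dynamics of the Lorentz force with frequency functional $\epsilon^{-1}\omega_c$, $\omega_c(\widetilde\zeta,\widetilde{\boldsymbol\xi})=\Omega_{-1}\big(\fint\widetilde{\boldsymbol\xi}\,d\theta\big)$, and transform it by $\Phi_\epsilon$, as a formal series in $\epsilon$, to the loop variables $\widetilde{\underline\zeta}(\theta)=\theta+\widetilde{\underline\nu}(\theta)$, $\widetilde{\underline{\boldsymbol\xi}}(\theta)$ and $S$, where $\widetilde{\underline\nu}$ and $\widetilde{\underline{\boldsymbol\xi}}$ are smooth and $2\pi$-periodic. **Statement.** Put $$x=(\overline{\underline\nu},\overline{\underline{\boldsymbol\xi}},\mathcal S)\in\mathbb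 R\times\mathbb R^5\times\mathbb R,\qquad y=(\widehat{\underline\nu},\widehat{\boldsymbol\varrho}),$$ where $\overline{\underline\nu}=\fint\widetilde{\underline\nu}\,d\theta$, $\overline{\underline{\boldsymbol\xi}}=\fint\widetilde{\underline{\boldsymbol\xi}}\,d\theta$, $\mathcal S=\epsilon S$, $\widehat{\underline\nu}=\widetilde{\underline\nu}-\overline{\underline\nu}$ and $\epsilon\,\widehat{\boldsymbol\varrho}=\widetilde{\underline{\boldsymbol\xi}}-\overline{\underline{\boldsymbol\xi}}$; thus $y$ lies in the space $Y$ of pairs of smooth loops (in $\mathbb R$ and in $\mathbb R^5$) with zero average. Then: 1. For every $\epsilon\ne0$ the map $(\widetilde{\underline\nu},\widetilde{\underline{\boldsymbol\xi}},S)\mapsto(x,y)$ is a bijection onto $\mathbb R\times\mathbb R^5\times\mathbb R\times Y$, and $\widetilde{\underline\nu}=\overline{\underline\nu}+\widehat{\underline\nu}$, $\widetilde{\underline{\boldsymbol\xi}}=\overline{\underline{\boldsymbol\xi}}+\epsilon\widehat{\boldsymbol\varrho}$. 2. In the variables $(x,y)$ with $\overline{\underline{\boldsymbol\xi}}\in D$,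 expanding in $\epsilon$ at fixed $(x,y)$, the dynamics is a formal fast–slow system $\epsilon\,\dot y=f_\epsilon(x,y)$, $\dot x=g_\epsilon(x,y)$: $f_\epsilon=f_0+\epsilon f_1+\cdots$ and $g_\epsilon=g_0+\epsilon g_1+\cdots$ are formal power series in $\epsilon$ (no negative powers) whose coefficients are smooth maps of $(x,y)$ into $Y$ and $\mathbb R\times\mathbb R^5\times\mathbb R$, and $D_yf_0(x,y)$ is invertible whenever $f_0(x,y)=0$. 3. More precisely, $f_0(x,y)=-\Omega_{-1}(\overline{\underline{\boldsymbol\xi}})\,\partial_\theta y$, and for all such $(x,y)$ the derivative $D_yf_0(x,y)$ is $-\Omega_{-1}(\overline{\underline{\boldsymbol\xi}})\,\partial_\theta$ with $\Omega_{-1}(\overline{\underline{\boldsymbol\xi}})\neq0$; it is an isomorphism of the space $Y$ of mean-zero smooth loops with its Fréchet topology. -/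

import Mathlib

open scoped ContDiff

noncomputable section

/-! ### Loops -/

/-- The average `(2π)⁻¹ ∫₀^{2π} f dθ`. -/
def loopMean {E : Type*} [NormedAddCommGroup E] [NormedSpace ℝ E] (f : ℝ → E) : E :=
  (2 * Real.pi)⁻¹ • ∫ θ in (0 : ℝ)..(2 * Real.pi), f θ

/-- The fluctuating part `f - (average of f)`. -/
def loopFluct {E : Type*} [NormedAddCommGroup E] [NormedSpace ℝ E] (f : ℝ → E) : ℝ → E :=
  fun θ => f θ - loopMean f

/-- Smooth loops in `E`: smooth `2π`-periodic maps `ℝ → E`. -/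
def smoothLoops (E : Type*) [NormedAddCommGroup E] [NormedSpace ℝ E] : Submodule ℝ (ℝ → E) where
  carrier := {f | ContDiff ℝ ∞ f ∧ Function.Periodic f (2 * Real.pi)}
  zero_mem' := ⟨contDiff_const, fun _ => rfl⟩
  add_mem' := fun ha hb => ⟨ha.1.add hb.1, ha.2.add hb.2⟩
  smul_mem' := fun c _ ha => ⟨contDiff_const.smul ha.1, ha.2.smul c⟩

/-- Smooth loops with vanishing average. -/
def meanZeroLoops (E : Type*) [NormedAddCommGroup E] [NormedSpace ℝ E] : Submodule ℝ (ℝ → E) where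
  carrier := {f | ContDiff ℝ ∞ f ∧ Function.Periodic f (2 * Real.pi) ∧ loopMean f = 0}
  zero_mem' := ⟨contDiff_const, fun _ => rfl, by simp [loopMean]⟩
  add_mem' := by
    intro a b ha hb
    refine ⟨ha.1.add hb.1, ha.2.1.add hb.2.1, ?_⟩
    have h1 := ha.2.2
    have h2 := hb.2.2
    simp only [loopMean] at h1 h2 ⊢
    simp only [Pi.add_apply]
    rw [intervalIntegral.integral_add (ha.1.continuous.intervalIntegrable _ _)
      (hb.1.continuous.intervalIntegrable _ _), smul_add, h1, h2, add_zero]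
  smul_mem' := by
    intro c a ha
    refine ⟨contDiff_const.smul ha.1, ha.2.1.smul c, ?_⟩
    have h1 := ha.2.2
    simp only [loopMean] at h1 ⊢
    simp only [Pi.smul_apply]
    rw [intervalIntegral.integral_smul, smul_comm, h1, smul_zero]

/-- The space of smooth loops in `E`. -/
def SmoothLoop (E : Type*) [NormedAddCommGroup E] [NormedSpace ℝ E] : Type _ := smoothLoops E

/-- The space of smooth loops in `E` with vanishing average. -/
def MeanZeroLoop (E : Type*) [NormedAddCommGroup E] [NormedSpace ℝ E] : Type _ := meanZeroLoops E

section LoopInstances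

variable {E : Type*} [NormedAddCommGroup E] [NormedSpace ℝ E]

instance : CoeFun (SmoothLoop E) (fun _ => ℝ → E) := ⟨fun f => f.1⟩

instance : CoeFun (MeanZeroLoop E) (fun _ => ℝ → E) := ⟨fun f => f.1⟩

instance : AddCommGroup (MeanZeroLoop E) := inferInstanceAs (AddCommGroup (meanZeroLoops E))

instance : Module ℝ (MeanZeroLoop E) := inferInstanceAs (Module ℝ (meanZeroLoops E))

/-- The `k`-th derivative of a mean-zero loop, as a continuous map. -/
def MeanZeroLoop.iterDeriv (f : MeanZeroLoop E) (k : ℕ) : C(ℝ, E) :=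
  ⟨iteratedDeriv k f, f.2.1.continuous_iteratedDeriv k (by exact_mod_cast le_top)⟩

/-- The Fréchet topology of smooth loops: uniform convergence of every derivative
(for periodic functions, uniform convergence is uniform convergence on compact sets). -/
instance : TopologicalSpace (MeanZeroLoop E) :=
  TopologicalSpace.induced (fun f => fun k : ℕ => f.iterDeriv k) inferInstance

/-- The operator `∂_θ` on mean-zero loops. -/
def MeanZeroLoop.dTheta (f : MeanZeroLoop E) : MeanZeroLoop E :=
  ⟨deriv f.1, by
    have hf := f.2
    have hd : ContDiff ℝ ∞ (deriv f.1) := by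
      have := (contDiff_infty_iff_deriv (𝕜 := ℝ)).1 hf.1
      exact this.2
    have hp : Function.Periodic f.1 (2 * Real.pi) := hf.2.1
    refine ⟨hd, ?_, ?_⟩
    · intro x
      have h : (fun t => f.1 (t + 2 * Real.pi)) = f.1 := funext hp
      have h2 := deriv_comp_add_const (f := f.1) (a := 2 * Real.pi) (x := x)
      rw [← h2, h]
    · have hdiff : Differentiable ℝ f.1 := hf.1.differentiable (by simp)
      unfold loopMean
      by_cases hE : CompleteSpace E
      · rw [intervalIntegral.integral_deriv_eq_sub (fun x _ => hdiff x)
          (hd.continuous.intervalIntegrable _ _)]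
        have := hp 0
        rw [zero_add] at this
        rw [this, sub_self, smul_zero]
      · simp [intervalIntegral, MeasureTheory.integral, hE]⟩

/-- The fluctuating part of a smooth loop, as a mean-zero loop. -/
def SmoothLoop.fluct [CompleteSpace E] (f : SmoothLoop E) : MeanZeroLoop E :=
  ⟨loopFluct f, by
    have hf := f.2
    refine ⟨hf.1.sub contDiff_const, fun x => ?_, ?_⟩
    · have := hf.2 x
      simp only [loopFluct]
      rw [this]
    · have h0 : (2 * Real.pi) ≠ 0 := by positivity
      change (2 * Real.pi)⁻¹ • ∫ θ in (0 : ℝ)..(2 * Real.pi), (f.1 θ - loopMean f.1) = 0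
      rw [intervalIntegral.integral_sub (hf.1.continuous.intervalIntegrable _ _)
        (by simp), intervalIntegral.integral_const, smul_sub, smul_smul, sub_zero,
        inv_mul_cancel₀ h0, one_smul]
      exact sub_self _⟩

end LoopInstances

/-! ### Formal series in `ε` -/

/-- The coefficient of `ε ^ n` in the Taylor expansion of `h` at `ε = 0`. -/
def taylorCoeff {E : Type*} [NormedAddCommGroup E] [NormedSpace ℝ E] (n : ℕ) (h : ℝ → E) : E :=
  (n.factorial : ℝ)⁻¹ • iteratedDeriv n h 0

/-- The truncation `∑_{k ≤ n} ε ^ k F_k` of a formal power series `∑_k ε ^ k F_k`. The coefficient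
of order `n` of any smooth expression in formal power series is the coefficient of order `n` of the
same expression in their truncations of order `n`. -/
def truncSeries {α E : Type*} [NormedAddCommGroup E] [NormedSpace ℝ E] (F : ℕ → α → E) (n : ℕ)
    (ε : ℝ) (a : α) : E :=
  ∑ k ∈ Finset.range (n + 1), ε ^ k • F k a

/-- The coefficients, indexed by `ℤ`, of a formal power series seen as a formal Laurent series. -/
def laurent {E : Type*} [Zero E] (c : ℕ → E) (m : ℤ) : E :=
  if 0 ≤ m then c m.toNat else 0

/-! ### The Lorentz force and its loop space dynamics -/

/-- Euclidean three-space. -/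
abbrev E3 : Type := EuclideanSpace ℝ (Fin 3)

/-- The space of the five non-angular coordinates. -/
abbrev E5 : Type := EuclideanSpace ℝ (Fin 5)

/-- The cross product in `ℝ³`. -/
def cross3 (v w : E3) : E3 := WithLp.toLp 2 (crossProduct v.ofLp w.ofLp)

/-- The Lorentz force vector field `(ẋ, v̇) = (v, ε⁻¹ v × B(x))` in the variables `(x, v)`. -/
def lorentzField (B : E3 → E3) (ε : ℝ) (p : E3 × E3) : E3 × E3 :=
  (p.2, ε⁻¹ • cross3 p.2 (B p.1))

/-- The loop component `X(z̃(θ)) - Ω(z̃) ∂_θ z̃(θ)` of the generator of the loop space dynamics of the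
vector field `X` with frequency functional `Ω`. (The phase component is `Ω(z̃)`.) -/
def loopGenerator {E : Type*} [NormedAddCommGroup E] [NormedSpace ℝ E] (X : E → E)
    (freq : (ℝ → E) → ℝ) (z : ℝ → E) (θ : ℝ) : E :=
  X (z θ) - freq z • deriv z θ

/-- Coordinates `(ζ, ξ)`, with `ζ` an angle and `ξ` in an open set of `ℝ⁵`, on an open part of the
phase space, in which the Lorentz force reads
`ζ̇ = ε⁻¹ Ω₋₁(ξ) + Ω₀(ζ, ξ)`, `ξ̇ = U₀(ζ, ξ)` with `Ω₋₁` nowhere zero. -/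
structure KruskalCoordinates (B : E3 → E3) where
  /-- the range of `ξ` -/
  dom : Set E5
  isOpen_dom : IsOpen dom
  /-- the phase space point with coordinates `(ζ, ξ)` -/
  chart : ℝ × E5 → E3 × E3
  chart_smooth : ContDiffOn ℝ ∞ chart (Set.univ ×ˢ dom)
  chart_fderiv_bijective : ∀ z ∈ Set.univ ×ˢ dom, Function.Bijective (fderiv ℝ chart z)
  chart_eq_iff : ∀ z ∈ Set.univ ×ˢ dom, ∀ w ∈ Set.univ ×ˢ dom,
    chart z = chart w ↔ z.2 = w.2 ∧ ∃ k : ℤ, z.1 = w.1 + 2 * Real.pi * k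
  /-- the function `Ω₋₁` -/
  Om1 : E5 → ℝ
  Om1_smooth : ContDiffOn ℝ ∞ Om1 dom
  Om1_ne_zero : ∀ ξ ∈ dom, Om1 ξ ≠ 0
  /-- the function `Ω₀` -/
  Om0 : ℝ × E5 → ℝ
  Om0_smooth : ContDiffOn ℝ ∞ Om0 (Set.univ ×ˢ dom)
  Om0_periodic : ∀ ζ, ∀ ξ ∈ dom, Om0 (ζ + 2 * Real.pi, ξ) = Om0 (ζ, ξ)
  /-- the function `U₀` -/
  U0 : ℝ × E5 → E5
  U0_smooth : ContDiffOn ℝ ∞ U0 (Set.univ ×ˢ dom)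
  U0_periodic : ∀ ζ, ∀ ξ ∈ dom, U0 (ζ + 2 * Real.pi, ξ) = U0 (ζ, ξ)
  lorentz : ∀ ε : ℝ, ε ≠ 0 → ∀ z ∈ Set.univ ×ˢ dom,
    fderiv ℝ chart z (ε⁻¹ * Om1 z.2 + Om0 z, U0 z) = lorentzField B ε (chart z)

namespace KruskalCoordinates

variable {B : E3 → E3} (K : KruskalCoordinates B)

/-- `ε` times the Lorentz force vector field, in the coordinates `(ζ, ξ)`. -/
def scaledField (ε : ℝ) (z : ℝ × E5) : ℝ × E5 :=
  (K.Om1 z.2 + ε * K.Om0 z, ε • K.U0 z)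

/-- `ω_c`, which is `ε` times the frequency functional: `Ω₋₁` at the average of `ξ̃`. -/
def omegaC (z : ℝ → ℝ × E5) : ℝ := K.Om1 (loopMean fun θ => (z θ).2)

end KruskalCoordinates

/-- A formal near-identity change of coordinates `Φ_ε = id + ε Φ₁ + ε² Φ₂ + ⋯`, with its formal
inverse `Ψ_ε`, that decouples the angle to all orders: in the new coordinates the Lorentz force is
the formal series `ζ̇ = ε⁻¹ Ω₋₁(ξ) + Ω̄_ε(ξ)`, `ξ̇ = Ū_ε(ξ)`. -/
structure AllOrdersTransformation {B : E3 → E3} (K : KruskalCoordinates B) where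
  /-- the coefficients of `Φ_ε` -/
  Phi : ℕ → ℝ × E5 → ℝ × E5
  Phi_smooth : ∀ k, ContDiffOn ℝ ∞ (Phi k) (Set.univ ×ˢ K.dom)
  Phi_zero : ∀ z ∈ Set.univ ×ˢ K.dom, Phi 0 z = z
  Phi_periodic : ∀ k ≠ 0, ∀ ζ, ∀ ξ ∈ K.dom, Phi k (ζ + 2 * Real.pi, ξ) = Phi k (ζ, ξ)
  /-- the coefficients of the inverse of `Φ_ε` -/
  Psi : ℕ → ℝ × E5 → ℝ × E5
  Psi_smooth : ∀ k, ContDiffOn ℝ ∞ (Psi k) (Set.univ ×ˢ K.dom)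
  Psi_zero : ∀ z ∈ Set.univ ×ˢ K.dom, Psi 0 z = z
  Psi_periodic : ∀ k ≠ 0, ∀ ζ, ∀ ξ ∈ K.dom, Psi k (ζ + 2 * Real.pi, ξ) = Psi k (ζ, ξ)
  Phi_Psi : ∀ n, ∀ z ∈ Set.univ ×ˢ K.dom,
    taylorCoeff n (fun ε => truncSeries Phi n ε (truncSeries Psi n ε z)) = if n = 0 then z else 0
  Psi_Phi : ∀ n, ∀ z ∈ Set.univ ×ˢ K.dom,
    taylorCoeff n (fun ε => truncSeries Psi n ε (truncSeries Phi n ε z)) = if n = 0 then z else 0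
  /-- the coefficients of `Ω̄_ε` -/
  OmBar : ℕ → E5 → ℝ
  OmBar_smooth : ∀ k, ContDiffOn ℝ ∞ (OmBar k) K.dom
  /-- the coefficients of `Ū_ε` -/
  UBar : ℕ → E5 → E5
  UBar_smooth : ∀ k, ContDiffOn ℝ ∞ (UBar k) K.dom
  decoupled : ∀ n, ∀ z ∈ Set.univ ×ˢ K.dom,
    taylorCoeff n (fun ε => fderiv ℝ (truncSeries Phi n ε) z (K.scaledField ε z)) =
      taylorCoeff n (fun ε =>
        ((K.Om1 (truncSeries Phi n ε z).2 + ε * truncSeries OmBar n ε (truncSeries Phi n ε z).2,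
          ε • truncSeries UBar n ε (truncSeries Phi n ε z).2) : ℝ × E5))

/-! ### The slow and fast variables -/

/-- The space of slow variables `x = (ν̄, ξ̄, 𝒮)`. -/
abbrev SlowSpace : Type := ℝ × E5 × ℝ

/-- The space of fast variables `y = (ν̂, ϱ̂)`. -/
abbrev FastSpace : Type := MeanZeroLoop ℝ × MeanZeroLoop E5

/-- The slow and fast variables of a loop `(ζ̃(θ), ξ̃(θ)) = (θ + ν̃(θ), ξ̃(θ))` with phase `S`. -/
def splitting (ε : ℝ) (q : SmoothLoop ℝ × SmoothLoop E5 × ℝ) : SlowSpace × FastSpace :=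
  ((loopMean q.1, loopMean q.2.1, ε * q.2.2), (q.1.fluct, ε⁻¹ • q.2.1.fluct))

/-- The loop `(θ + ν̄ + ν̂(θ), ξ̄ + ε ϱ̂(θ))` with slow and fast variables `(x, y)`. -/
def reconstruct (ε : ℝ) (p : SlowSpace × FastSpace) (θ : ℝ) : ℝ × E5 :=
  (θ + p.1.1 + p.2.1 θ, p.1.2.1 + ε • p.2.2 θ)

/-- The states whose average `ξ̄` lies in the coordinate domain. -/
def KruskalCoordinates.states {B : E3 → E3} (K : KruskalCoordinates B) :
    Set (SlowSpace × FastSpace) :=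
  {p | p.1.2.1 ∈ K.dom}

namespace AllOrdersTransformation

variable {B : E3 → E3} {K : KruskalCoordinates B} (T : AllOrdersTransformation K)

/-- Coefficient of `ε ^ n` of `ε` times the loop component of the loop space generator of the
Lorentz force, transformed by `Φ_ε` (push-forward `DΦ_ε(z̃)[·]` at `z̃ = Φ_ε⁻¹(loop)`), at the loop
with slow and fast variables `p`. -/
def loopCoeff (n : ℕ) (p : SlowSpace × FastSpace) (θ : ℝ) : ℝ × E5 :=
  taylorCoeff n (fun ε =>
    fderiv ℝ (truncSeries T.Phi n ε) (truncSeries T.Psi n ε (reconstruct ε p θ))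
      (loopGenerator (K.scaledField ε) K.omegaC
        (fun t => truncSeries T.Psi n ε (reconstruct ε p t)) θ))

/-- Coefficient of `ε ^ n` of `ε Ṡ = ω_c(Φ_ε⁻¹(loop))`. -/
def phaseCoeff (n : ℕ) (p : SlowSpace × FastSpace) : ℝ :=
  taylorCoeff n (fun ε => K.omegaC (fun t => truncSeries T.Psi n ε (reconstruct ε p t)))

/-- Coefficient of `ε ^ m` of the rate of change of the loop `(ζ̃, ξ̃)`. -/
def loopRate (m : ℤ) (p : SlowSpace × FastSpace) : ℝ → ℝ × E5 :=
  laurent (fun n => T.loopCoeff n p) (m + 1)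

/-- Coefficient of `ε ^ m` of `ẋ`, the rate of change of the averages of `ν̃`, `ξ̃` and of
`𝒮 = ε S`. -/
def slowRate (m : ℤ) (p : SlowSpace × FastSpace) : SlowSpace :=
  (loopMean fun θ => (T.loopRate m p θ).1, loopMean fun θ => (T.loopRate m p θ).2,
    laurent (fun n => T.phaseCoeff n p) m)

/-- Coefficient of `ε ^ m` of `ẏ`: the fluctuating part of the rate of change of `ν̃`, and `ε⁻¹` times
the fluctuating part of the rate of change of `ξ̃`. -/
def fastRate (m : ℤ) (p : SlowSpace × FastSpace) : (ℝ → ℝ) × (ℝ → E5) :=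
  (loopFluct fun θ => (T.loopRate m p θ).1, loopFluct fun θ => (T.loopRate (m + 1) p θ).2)

end AllOrdersTransformation

/-! ### Fast-slow systems -/

/-- Smooth curves in the product of the slow space and the (Fréchet) fast space. -/
def IsSmoothCurve (c : ℝ → SlowSpace × FastSpace) : Prop :=
  ContDiff ℝ ∞ (fun s => (c s).1) ∧
    ContDiff ℝ ∞ (fun q : ℝ × ℝ => (c q.1).2.1 q.2) ∧
    ContDiff ℝ ∞ (fun q : ℝ × ℝ => (c q.1).2.2 q.2)

/-- `L` is the (Gateaux) derivative of `F` at `y`. -/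
def HasDerivativeAt {Y : Type*} [AddCommGroup Y] [Module ℝ Y] [TopologicalSpace Y]
    (F : Y → Y) (L : Y →L[ℝ] Y) (y : Y) : Prop :=
  ∀ h : Y, Filter.Tendsto (fun s : ℝ => s⁻¹ • (F (y + s • h) - F y))
    (nhdsWithin 0 {0}ᶜ) (nhds (L h))

/-- The formal system `ε ẏ = ∑ ε ^ n f_n(x, y)`, `ẋ = ∑ ε ^ n g_n(x, y)` on `U` is fast-slow: the
coefficients are smooth on `U` (a map between Fréchet spaces is smooth iff it maps smooth curves
to smooth curves) and `D_y f₀(x, y)` is invertible whenever `f₀(x, y) = 0`. -/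
def IsFormalFastSlow (U : Set (SlowSpace × FastSpace))
    (f : ℕ → SlowSpace × FastSpace → FastSpace) (g : ℕ → SlowSpace × FastSpace → SlowSpace) :
    Prop :=
  (∀ n, ∀ c : ℝ → SlowSpace × FastSpace, IsSmoothCurve c → (∀ s, c s ∈ U) →
    IsSmoothCurve (fun s => (g n (c s), f n (c s)))) ∧
  ∀ p ∈ U, f 0 p = 0 →
    ∃ L : FastSpace ≃L[ℝ] FastSpace,
      HasDerivativeAt (fun y => f 0 (p.1, y)) (L : FastSpace →L[ℝ] FastSpace) p.2

end

/-! Near `ε = 0` the transformed generator, built from truncated series, is jointly smooth in `ε`,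
the angle and the parameter of any smooth curve of states (`contDiffAt_truncGenerator`). Its Taylor
coefficients are therefore smooth along curves. They are also periodic, since shifting the angle by
`2π` commutes with `Φ`, `Ψ` and the field. So they define loops, and their averages and fluctuations
give `g` and `f`.

The rest is the absence of negative powers and the value of `f 0`, for which two low orders suffice.
At `ε = 0` the loop has constant `ξ`-component `ξ̄`, the frequency equals `Ω₋₁(ξ̄)`, and the
rotation in the field cancels against the frequency term. What remains is `(-Ω₋₁(ξ̄) ∂_θ ν̂, 0)`
(`loopCoeff_zero`). It has zero mean, so `ẋ` has no term of order `ε⁻¹`; its `ξ`-component vanishes,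
so the rescaling `ξ̃ = ξ̄ + ε ϱ̂` costs nothing.

The next `ξ`-coefficient is `Ū₀(ξ̄) - Ω₋₁(ξ̄) ∂_θ ϱ̂` (`loopCoeff_one_snd`). This is where
decoupling enters: `Ψ₁ = -Φ₁` makes the terms containing `∂_θ ν̂` cancel, and the first-order
homological equation `U0_add_fderiv_Phi_one` replaces `U₀` by its angle-free counterpart. As
`Ū₀(ξ̄)` is constant in `θ`, taking fluctuations removes it, and `f 0 = -Ω₋₁(ξ̄) ∂_θ y`.

For fixed `x` this is linear in `y`, hence its own derivative; it is inverted by the mean-zero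
antiderivative, which is continuous for the Fréchet topology (`MeanZeroLoop.continuous_antideriv`).
-/

noncomputable section

/-! ### Taylor coefficients and integrals depending on parameters -/

section ParametricCalculus

open Filter Topology

/-- Each derivative in the first variable is the full Fréchet derivative evaluated on `(1, 0)`, so
joint smoothness survives the induction. -/
theorem ContDiffAt.iteratedDeriv_slice {P E : Type*} [NormedAddCommGroup P] [NormedSpace ℝ P]
    [NormedAddCommGroup E] [NormedSpace ℝ E] {G : ℝ → P → E} {a : ℝ × P}
    (hG : ContDiffAt ℝ ∞ (fun x : ℝ × P => G x.1 x.2) a) (n : ℕ) :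
    ContDiffAt ℝ ∞ (fun x : ℝ × P => iteratedDeriv n (fun e => G e x.2) x.1) a := by
  induction n with
  | zero => simpa using hG
  | succ n ih =>
    have h1 : ContDiffAt ℝ ∞ (fun x : ℝ × P => fderiv ℝ
        (fun x : ℝ × P => iteratedDeriv n (fun e => G e x.2) x.1) x (1, 0)) a :=
      (ih.fderiv_right (m := ∞) (by simp)).clm_apply contDiffAt_const
    refine h1.congr_of_eventuallyEq ?_
    have h2 := (ih.of_le (m := 1) (by exact_mod_cast le_top)).eventually (by simp)
    filter_upwards [h2] with x hx
    have h3 := (hx.differentiableAt (by simp)).hasFDerivAt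
    have h4 : HasDerivAt (fun e : ℝ => (e, x.2)) ((1 : ℝ), (0 : P)) x.1 :=
      (hasDerivAt_id _).prodMk (hasDerivAt_const _ _)
    have h5 := HasFDerivAt.comp_hasDerivAt (f := fun e : ℝ => (e, x.2)) x.1 h3 h4
    rw [iteratedDeriv_succ]
    exact h5.deriv

theorem ContDiffAt.taylorCoeff {P E : Type*} [NormedAddCommGroup P] [NormedSpace ℝ P]
    [NormedAddCommGroup E] [NormedSpace ℝ E] {G : ℝ → P → E} {q : P}
    (hG : ContDiffAt ℝ ∞ (fun x : ℝ × P => G x.1 x.2) (0, q)) (n : ℕ) :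
    ContDiffAt ℝ ∞ (fun q => _root_.taylorCoeff n (fun e => G e q)) q :=
  contDiffAt_const.smul
    (ContDiffAt.comp q (hG.iteratedDeriv_slice n) (contDiffAt_const.prodMk contDiffAt_id))

theorem Filter.EventuallyEq.taylorCoeff_eq {E : Type*} [NormedAddCommGroup E] [NormedSpace ℝ E]
    {f g : ℝ → E} (h : f =ᶠ[𝓝 0] g) (n : ℕ) : taylorCoeff n f = taylorCoeff n g := by
  simp only [taylorCoeff, h.iteratedDeriv_eq n]

/-- Compactness of the interval turns pointwise bounds into one constant valid near `q`; it serves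
as the dominating function below. -/
theorem eventually_forall_uIcc_norm_le {P E : Type*} [TopologicalSpace P]
    [NormedAddCommGroup E] {h : P × ℝ → E} {q : P} {a b : ℝ}
    (hc : ∀ t ∈ Set.uIcc a b, ContinuousAt h (q, t)) :
    ∃ C, ∀ᶠ p in 𝓝 q, ∀ t ∈ Set.uIcc a b, ‖h (p, t)‖ ≤ C := by
  have h1 : ContinuousOn (fun t => h (q, t)) (Set.uIcc a b) := fun t ht =>
    (ContinuousAt.comp (f := fun t : ℝ => (q, t)) (hc t ht) (by fun_prop)).continuousWithinAt
  obtain ⟨C, hC⟩ := isCompact_uIcc.exists_bound_of_continuousOn h1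
  refine ⟨C + 1, isCompact_uIcc.eventually_forall_of_forall_eventually fun t ht => ?_⟩
  have h2 := (hc t ht).norm.eventually_lt_const (lt_of_le_of_lt (hC t ht) (lt_add_one C))
  filter_upwards [h2] with x hx using hx.le

theorem continuousAt_intervalIntegral {P E : Type*} [NormedAddCommGroup P] [NormedSpace ℝ P]
    [NormedAddCommGroup E] [NormedSpace ℝ E] {h : P × ℝ → E} {q : P} {a b : ℝ}
    (hc : ∀ᶠ p in 𝓝 q, ∀ t ∈ Set.uIcc a b, ContinuousAt h (p, t)) :
    ContinuousAt (fun p => ∫ t in a..b, h (p, t)) q := by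
  obtain ⟨C, hC⟩ := eventually_forall_uIcc_norm_le hc.self_of_nhds
  refine intervalIntegral.continuousAt_of_dominated_interval (bound := fun _ => C) ?_ ?_ (by simp) ?_
  · filter_upwards [hc] with p hp
    have : ContinuousOn (fun t => h (p, t)) (Set.uIcc a b) := fun t ht =>
      (ContinuousAt.comp (f := fun t : ℝ => (p, t)) (hp t ht) (by fun_prop)).continuousWithinAt
    exact (this.mono Set.uIoc_subset_uIcc).aestronglyMeasurable measurableSet_uIoc
  · filter_upwards [hC] with p hp
    exact Eventually.of_forall fun t ht => hp t (Set.uIoc_subset_uIcc ht)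
  · exact Eventually.of_forall fun t ht =>
      ContinuousAt.comp (f := fun p : P => (p, t)) (hc.self_of_nhds t (Set.uIoc_subset_uIcc ht))
        (by fun_prop)

theorem hasFDerivAt_intervalIntegral {P E : Type*} [NormedAddCommGroup P] [NormedSpace ℝ P]
    [NormedAddCommGroup E] [NormedSpace ℝ E] {h : P × ℝ → E} {q : P} {a b : ℝ}
    (hc : ∀ᶠ p in 𝓝 q, ∀ t ∈ Set.uIcc a b, ContDiffAt ℝ 1 h (p, t)) :
    HasFDerivAt (fun p => ∫ t in a..b, h (p, t))
      (∫ t in a..b, (fderiv ℝ h (q, t)).comp (ContinuousLinearMap.inl ℝ P ℝ)) q := by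
  have hcont : ∀ p, (∀ t ∈ Set.uIcc a b, ContDiffAt ℝ 1 h (p, t)) →
      ContinuousOn (fun t => h (p, t)) (Set.uIcc a b) := fun p hp t ht =>
    (ContinuousAt.comp (f := fun t : ℝ => (p, t)) (hp t ht).continuousAt
      (by fun_prop)).continuousWithinAt
  have hd : ∀ t ∈ Set.uIcc a b, ContinuousAt
      (fun x => (fderiv ℝ h x).comp (ContinuousLinearMap.inl ℝ P ℝ)) (q, t) := fun t ht =>
    ((hc.self_of_nhds t ht).fderiv_right (m := 0) (by simp)).continuousAt.clm_comp
      continuousAt_const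
  obtain ⟨C, hC⟩ := eventually_forall_uIcc_norm_le hd
  refine intervalIntegral.hasFDerivAt_integral_of_dominated_of_fderiv_le
    (F := fun p t => h (p, t)) (bound := fun _ => C)
    (F' := fun p t => (fderiv ℝ h (p, t)).comp (ContinuousLinearMap.inl ℝ P ℝ))
    (hc.and hC) ?_ ?_ ?_ ?_ (by simp) ?_
  · filter_upwards [hc] with p hp
    exact ((hcont p hp).mono Set.uIoc_subset_uIcc).aestronglyMeasurable measurableSet_uIoc
  · exact (hcont q hc.self_of_nhds).intervalIntegrable
  · refine ContinuousOn.aestronglyMeasurable (fun t ht => ?_) measurableSet_uIoc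
    exact (ContinuousAt.comp (f := fun t : ℝ => (q, t)) (hd t (Set.uIoc_subset_uIcc ht))
      (by fun_prop)).continuousWithinAt
  · exact Eventually.of_forall fun t ht p hp => hp.2 t (Set.uIoc_subset_uIcc ht)
  · refine Eventually.of_forall fun t ht p hp => ?_
    have h1 := ((hp.1 t (Set.uIoc_subset_uIcc ht)).differentiableAt (by simp)).hasFDerivAt
    exact h1.comp p ((hasFDerivAt_id p).prodMk (hasFDerivAt_const t p))

/-- Induction on the order, by differentiating under the integral. The target `E` is quantified
inside the induction because the derivative takes values in `P →L[ℝ] E`; keeping both spaces in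
`Type` keeps that space in the same universe. -/
theorem contDiffAt_intervalIntegral_nat {P : Type} [NormedAddCommGroup P] [NormedSpace ℝ P]
    {a b : ℝ} {q : P} (n : ℕ) : ∀ {E : Type} [NormedAddCommGroup E] [NormedSpace ℝ E]
    {h : P × ℝ → E}, (∀ t ∈ Set.uIcc a b, ContDiffAt ℝ n h (q, t)) →
    ContDiffAt ℝ n (fun p => ∫ t in a..b, h (p, t)) q := by
  induction n with
  | zero =>
    intro E _ _ h hh
    have h1 : ∀ᶠ p in 𝓝 q, ∀ t ∈ Set.uIcc a b, ContDiffAt ℝ 0 h (p, t) :=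
      isCompact_uIcc.eventually_forall_of_forall_eventually fun t ht =>
        (hh t ht).eventually (by simp)
    refine contDiffAt_zero.2 ⟨_, eventually_eventually_nhds.2 h1, fun p hp => ?_⟩
    exact (continuousAt_intervalIntegral (hp.mono fun p hp t ht =>
      (hp t ht).continuousAt)).continuousWithinAt
  | succ n ih =>
    intro E _ _ h hh
    have h1 : ∀ᶠ p in 𝓝 q, ∀ t ∈ Set.uIcc a b, ContDiffAt ℝ ((n + 1 : ℕ) : WithTop ℕ∞) h (p, t) :=
      isCompact_uIcc.eventually_forall_of_forall_eventually fun t ht =>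
        (hh t ht).eventually (by simp)
    refine contDiffAt_succ_iff_hasFDerivAt.2 ⟨fun p => ∫ t in a..b,
      (fderiv ℝ h (p, t)).comp (ContinuousLinearMap.inl ℝ P ℝ),
      ⟨_, eventually_eventually_nhds.2 h1, fun p hp => ?_⟩, ?_⟩
    · exact hasFDerivAt_intervalIntegral (hp.mono fun p hp t ht =>
        (hp t ht).of_le (by exact_mod_cast Nat.le_add_left 1 n))
    · exact ih fun t ht => ((hh t ht).fderiv_right (m := n) (by simp)).clm_comp
        (contDiffAt_const (c := ContinuousLinearMap.inl ℝ P ℝ))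

theorem contDiffAt_loopMean {P E : Type} [NormedAddCommGroup P] [NormedSpace ℝ P]
    [NormedAddCommGroup E] [NormedSpace ℝ E] {h : P → ℝ → E} {q : P}
    (hh : ∀ t, ContDiffAt ℝ ∞ (fun x : P × ℝ => h x.1 x.2) (q, t)) :
    ContDiffAt ℝ ∞ (fun p => loopMean (h p)) q := by
  refine contDiffAt_const.smul (contDiffAt_infty.2 fun n => ?_)
  exact contDiffAt_intervalIntegral_nat n (h := fun x : P × ℝ => h x.1 x.2)
    fun t _ => (hh t).of_le (by exact_mod_cast le_top)

end ParametricCalculus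

/-! ### Mean-zero loops and the inverse of `∂_θ` -/

section MeanZeroLoops

variable {E : Type*} [NormedAddCommGroup E] [NormedSpace ℝ E]

theorem loopMean_const [CompleteSpace E] (c : E) : loopMean (fun _ => c) = c := by
  simp [loopMean, intervalIntegral.integral_const, smul_smul, -mul_inv_rev]

theorem loopMean_add {f g : ℝ → E} (hf : Continuous f) (hg : Continuous g) :
    loopMean (fun θ => f θ + g θ) = loopMean f + loopMean g := by
  simp only [loopMean]
  rw [intervalIntegral.integral_add (hf.intervalIntegrable _ _) (hg.intervalIntegrable _ _),
    smul_add]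

theorem loopMean_smul (c : ℝ) (f : ℝ → E) : loopMean (fun θ => c • f θ) = c • loopMean f := by
  simp only [loopMean]
  rw [intervalIntegral.integral_smul, smul_comm]

theorem MeanZeroLoop.ext {f g : MeanZeroLoop E} (h : ∀ θ, f θ = g θ) : f = g :=
  Subtype.ext (funext h)

theorem SmoothLoop.ext {f g : SmoothLoop E} (h : ∀ θ, f θ = g θ) : f = g :=
  Subtype.ext (funext h)

theorem MeanZeroLoop.smul_apply (c : ℝ) (f : MeanZeroLoop E) (θ : ℝ) : (c • f) θ = c • f θ := rfl

theorem MeanZeroLoop.contDiff (f : MeanZeroLoop E) : ContDiff ℝ ∞ f := f.2.1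

theorem MeanZeroLoop.periodic (f : MeanZeroLoop E) : Function.Periodic f (2 * Real.pi) := f.2.2.1

theorem MeanZeroLoop.loopMean_eq_zero (f : MeanZeroLoop E) : loopMean f = 0 := f.2.2.2

theorem MeanZeroLoop.dTheta_add (f g : MeanZeroLoop E) :
    (f + g).dTheta = f.dTheta + g.dTheta :=
  MeanZeroLoop.ext fun θ => deriv_add (f.contDiff.differentiable (by simp) θ)
    (g.contDiff.differentiable (by simp) θ)

theorem MeanZeroLoop.dTheta_smul (c : ℝ) (f : MeanZeroLoop E) :
    (c • f).dTheta = c • f.dTheta :=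
  MeanZeroLoop.ext fun θ => deriv_const_smul c (f.contDiff.differentiable (by simp) θ)

theorem MeanZeroLoop.iterDeriv_dTheta (f : MeanZeroLoop E) (k : ℕ) :
    f.dTheta.iterDeriv k = f.iterDeriv (k + 1) :=
  ContinuousMap.ext fun θ => (congrFun iteratedDeriv_succ' θ).symm

theorem MeanZeroLoop.iterDeriv_smul (c : ℝ) (f : MeanZeroLoop E) (k : ℕ) :
    (c • f).iterDeriv k = c • f.iterDeriv k :=
  ContinuousMap.ext fun θ => iteratedDeriv_const_smul
    (f.contDiff.contDiffAt.of_le (by exact_mod_cast le_top)) c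

theorem MeanZeroLoop.continuous_iterDeriv (k : ℕ) :
    Continuous fun f : MeanZeroLoop E => f.iterDeriv k :=
  continuous_pi_iff.1 (continuous_induced_dom
    (f := fun f : MeanZeroLoop E => fun k : ℕ => f.iterDeriv k)) k

theorem MeanZeroLoop.continuous_of_iterDeriv {X : Type*} [TopologicalSpace X]
    {F : X → MeanZeroLoop E} (h : ∀ k, Continuous fun x => (F x).iterDeriv k) : Continuous F :=
  continuous_induced_rng.2 (continuous_pi h)

/-- The mean-zero antiderivative of a mean-zero loop. -/
def MeanZeroLoop.antideriv [CompleteSpace E] (f : MeanZeroLoop E) : MeanZeroLoop E :=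
  SmoothLoop.fluct ⟨fun x => ∫ t in (0 : ℝ)..x, f t, by
    have hf := f.contDiff.continuous
    have hd : ∀ x, HasDerivAt (fun x => ∫ t in (0 : ℝ)..x, f t) (f x) x := fun x =>
      hf.integral_hasStrictDerivAt 0 x |>.hasDerivAt
    refine ⟨contDiff_infty_iff_deriv.2 ⟨fun x => (hd x).differentiableAt, ?_⟩, fun x => ?_⟩
    · rw [show deriv (fun x => ∫ t in (0 : ℝ)..x, f t) = f from funext fun x => (hd x).deriv]
      exact f.contDiff
    -- Vanishing mean is exactly the condition for the primitive to be periodic.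
    · have h1 : ∫ t in x..x + 2 * Real.pi, f t = 0 := by
        have h2 := f.periodic.intervalIntegral_add_eq x 0
        rw [zero_add] at h2
        rw [h2]
        have h3 := f.loopMean_eq_zero
        have h0 : (2 * Real.pi)⁻¹ ≠ 0 := by positivity
        exact (smul_eq_zero.1 h3).resolve_left h0
      simp only
      rw [← intervalIntegral.integral_add_adjacent_intervals (hf.intervalIntegrable 0 x)
        (hf.intervalIntegrable x _), h1, add_zero]⟩

theorem MeanZeroLoop.antideriv_apply [CompleteSpace E] (f : MeanZeroLoop E) (θ : ℝ) :
    f.antideriv θ = (∫ t in (0 : ℝ)..θ, f t) - loopMean fun x => ∫ t in (0 : ℝ)..x, f t := rfl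

theorem MeanZeroLoop.dTheta_antideriv [CompleteSpace E] (f : MeanZeroLoop E) :
    f.antideriv.dTheta = f :=
  MeanZeroLoop.ext fun θ => by
    have h := ((f.contDiff.continuous.integral_hasStrictDerivAt 0 θ).hasDerivAt.sub_const
      (loopMean fun x => ∫ t in (0 : ℝ)..x, f t))
    exact h.deriv

/-- Integrating the derivative loses only the constant `f 0`, which the normalisation to zero mean
restores. -/
theorem MeanZeroLoop.antideriv_dTheta [CompleteSpace E] (f : MeanZeroLoop E) :
    f.dTheta.antideriv = f :=
  MeanZeroLoop.ext fun θ => by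
    have h : ∀ x, ∫ t in (0 : ℝ)..x, f.dTheta t = f x + (- f 0) := fun x => by
      rw [← sub_eq_add_neg]
      exact intervalIntegral.integral_deriv_eq_sub
        (fun y _ => f.contDiff.differentiable (by simp) y)
        (f.dTheta.contDiff.continuous.intervalIntegrable _ _)
    rw [antideriv_apply]
    simp only [h]
    rw [loopMean_add f.contDiff.continuous continuous_const, loopMean_const, f.loopMean_eq_zero]
    simp

theorem MeanZeroLoop.continuous_dTheta :
    Continuous (MeanZeroLoop.dTheta : MeanZeroLoop E → MeanZeroLoop E) :=
  continuous_of_iterDeriv fun k => by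
    simp only [iterDeriv_dTheta]
    exact continuous_iterDeriv _

theorem MeanZeroLoop.continuous_smul_const (c : ℝ) :
    Continuous fun f : MeanZeroLoop E => c • f :=
  continuous_of_iterDeriv fun k => by
    simp only [iterDeriv_smul]
    exact (continuous_iterDeriv k).const_smul c

/-- Derivatives of positive order of the antiderivative are derivatives of `f` of one order less, so
only order zero needs an estimate on integrals. -/
theorem MeanZeroLoop.continuous_antideriv [CompleteSpace E] :
    Continuous (MeanZeroLoop.antideriv : MeanZeroLoop E → MeanZeroLoop E) := by
  refine continuous_of_iterDeriv fun k => ?_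
  cases k with
  | succ k =>
    have : ∀ f : MeanZeroLoop E, f.antideriv.iterDeriv (k + 1) = f.iterDeriv k := fun f => by
      rw [← iterDeriv_dTheta, dTheta_antideriv]
    simp only [this]
    exact continuous_iterDeriv k
  | zero =>
    -- The integral is jointly continuous in the integrand (compact-open topology) and the endpoint;
    -- currying then gives continuity into `C(ℝ, E)`.
    have h1 : Continuous fun p : C(ℝ, E) × ℝ => ∫ t in (0 : ℝ)..p.2, p.1 t :=
      intervalIntegral.continuous_parametric_intervalIntegral_of_continuous
        (f := fun (p : C(ℝ, E) × ℝ) t => p.1 t) (by fun_prop) (by fun_prop)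
    have h2 : Continuous fun p : C(ℝ, E) => loopMean fun x => ∫ t in (0 : ℝ)..x, p t :=
      (intervalIntegral.continuous_parametric_intervalIntegral_of_continuous'
        (f := fun (p : C(ℝ, E)) x => ∫ t in (0 : ℝ)..x, p t) h1 _ _).const_smul _
    refine ContinuousMap.continuous_of_continuous_uncurry _ ?_
    have h3 : Continuous fun x : MeanZeroLoop E × ℝ => (x.1.iterDeriv 0, x.2) :=
      ((continuous_iterDeriv 0).comp continuous_fst).prodMk continuous_snd
    exact (h1.sub (h2.comp continuous_fst)).comp h3

/-- A nonzero multiple of `∂_θ`, as an isomorphism of the space of mean-zero loops. -/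
def MeanZeroLoop.smulDThetaEquiv [CompleteSpace E] (c : ℝ) (hc : c ≠ 0) :
    MeanZeroLoop E ≃L[ℝ] MeanZeroLoop E where
  toFun f := c • f.dTheta
  invFun f := antideriv (c⁻¹ • f)
  map_add' f g := by rw [dTheta_add, smul_add]
  map_smul' r f := by rw [dTheta_smul, smul_comm]; rfl
  left_inv f := by
    change antideriv (c⁻¹ • c • f.dTheta) = f
    rw [smul_smul, inv_mul_cancel₀ hc, one_smul, antideriv_dTheta]
  right_inv f := by
    change c • (antideriv (c⁻¹ • f)).dTheta = f
    rw [dTheta_antideriv, smul_smul, mul_inv_cancel₀ hc, one_smul]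
  continuous_toFun := (continuous_smul_const c).comp continuous_dTheta
  continuous_invFun := continuous_antideriv.comp (continuous_smul_const c⁻¹)

theorem SmoothLoop.fluct_apply [CompleteSpace E] (f : SmoothLoop E) (θ : ℝ) :
    f.fluct θ = f θ - loopMean f := rfl

/-- The loop with average `c` and fluctuating part `f`. -/
def MeanZeroLoop.addConst (c : E) (f : MeanZeroLoop E) : SmoothLoop E :=
  ⟨fun θ => c + f θ, contDiff_const.add f.contDiff, fun θ => by simp only [f.periodic θ]⟩

theorem MeanZeroLoop.loopMean_addConst [CompleteSpace E] (c : E) (f : MeanZeroLoop E) :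
    loopMean (f.addConst c) = c := by
  change loopMean (fun θ => c + f θ) = c
  rw [loopMean_add continuous_const f.contDiff.continuous, loopMean_const, f.loopMean_eq_zero,
    add_zero]

theorem MeanZeroLoop.fluct_addConst [CompleteSpace E] (c : E) (f : MeanZeroLoop E) :
    (f.addConst c).fluct = f :=
  MeanZeroLoop.ext fun θ => by
    rw [SmoothLoop.fluct_apply, loopMean_addConst]
    exact add_sub_cancel_left c (f θ)

theorem SmoothLoop.addConst_fluct [CompleteSpace E] (f : SmoothLoop E) :
    f.fluct.addConst (loopMean f) = f :=
  SmoothLoop.ext fun θ => add_sub_cancel (loopMean f) (f θ)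

end MeanZeroLoops

/-! ### The change to slow and fast variables -/

theorem splitting_bijective {ε : ℝ} (hε : ε ≠ 0) : Function.Bijective (splitting ε) := by
  refine Function.bijective_iff_has_inverse.2 ⟨fun p =>
    (p.2.1.addConst p.1.1, (ε • p.2.2).addConst p.1.2.1, ε⁻¹ * p.1.2.2), ?_, ?_⟩
  · rintro ⟨ν, ξ, S⟩
    simp only [splitting, SmoothLoop.addConst_fluct, smul_smul, mul_inv_cancel₀ hε, one_smul,
      ← mul_assoc, inv_mul_cancel₀ hε, one_mul]
  · rintro ⟨⟨a, b, s⟩, y, z⟩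
    simp only [splitting, MeanZeroLoop.fluct_addConst, MeanZeroLoop.loopMean_addConst, smul_smul,
      mul_inv_cancel₀ hε, one_smul, ← mul_assoc, inv_mul_cancel₀ hε, one_mul]

theorem reconstruct_splitting {ε : ℝ} (hε : ε ≠ 0) (ν : SmoothLoop ℝ) (ξ : SmoothLoop E5)
    (S θ : ℝ) : reconstruct ε (splitting ε (ν, ξ, S)) θ = (θ + ν θ, ξ θ) := by
  simp only [reconstruct, splitting, MeanZeroLoop.smul_apply, SmoothLoop.fluct_apply, smul_smul,
    mul_inv_cancel₀ hε, one_smul, add_sub_cancel, add_assoc]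

theorem hasDerivativeAt_of_linear {Y : Type*} [AddCommGroup Y] [Module ℝ Y] [TopologicalSpace Y]
    {F : Y → Y} (L : Y →L[ℝ] Y) (h : ∀ y, F y = L y) (y : Y) : HasDerivativeAt F L y := by
  intro k
  refine tendsto_const_nhds.congr' ?_
  filter_upwards [self_mem_nhdsWithin] with s hs
  have hs : s ≠ 0 := hs
  rw [h, h, map_add, add_sub_cancel_left, map_smul, smul_smul, inv_mul_cancel₀ hs, one_smul]

/-! ### Truncated series and their first-order coefficients -/

section TruncatedSeries

open Filter Topology

theorem truncSeries_zero_right {α E : Type*} [NormedAddCommGroup E] [NormedSpace ℝ E]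
    (F : ℕ → α → E) (n : ℕ) (a : α) : truncSeries F n 0 a = F 0 a := by
  rw [truncSeries, Finset.sum_range_succ']
  simp

theorem truncSeries_one {α E : Type*} [NormedAddCommGroup E] [NormedSpace ℝ E]
    (F : ℕ → α → E) (ε : ℝ) (a : α) : truncSeries F 1 ε a = F 0 a + ε • F 1 a := by
  simp [truncSeries, Finset.sum_range_succ]

theorem contDiffAt_truncSeries {α E : Type*} [NormedAddCommGroup α] [NormedSpace ℝ α]
    [NormedAddCommGroup E] [NormedSpace ℝ E] {F : ℕ → α → E} {a : α}
    (hF : ∀ k, ContDiffAt ℝ ∞ (F k) a) (n : ℕ) (ε : ℝ) :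
    ContDiffAt ℝ ∞ (fun x : ℝ × α => truncSeries F n x.1 x.2) (ε, a) := by
  unfold truncSeries
  exact ContDiffAt.sum fun k _ => (contDiffAt_fst.pow k).smul
    (ContDiffAt.comp (ε, a) (hF k) contDiffAt_snd)

/-- The shift is carried by the identity term alone; all higher terms are invariant. -/
theorem truncSeries_shift {E : Type*} [NormedAddCommGroup E] [NormedSpace ℝ E]
    {F : ℕ → E → E} {z v : E} (h0 : F 0 z = z) (h0' : F 0 (z + v) = z + v)
    (hF : ∀ k ≠ 0, F k (z + v) = F k z) (n : ℕ) (ε : ℝ) :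
    truncSeries F n ε (z + v) = truncSeries F n ε z + v := by
  simp only [truncSeries, Finset.sum_range_succ' _ n, h0, h0', hF _ (Nat.succ_ne_zero _)]
  simp [add_assoc]

/-- The difference quotient at `0` is `h` itself, so continuity of `h` suffices. This lets
first-order coefficients be read off after dividing by `ε`, without differentiating the quotient. -/
theorem hasDerivAt_smul_self {E : Type*} [NormedAddCommGroup E] [NormedSpace ℝ E] {h : ℝ → E}
    (hh : ContinuousAt h 0) : HasDerivAt (fun ε => ε • h ε) (h 0) 0 := by
  rw [hasDerivAt_iff_tendsto_slope_zero]
  refine (hh.tendsto.mono_left nhdsWithin_le_nhds).congr' ?_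
  filter_upwards [self_mem_nhdsWithin] with t ht
  have ht : t ≠ 0 := ht
  simp [smul_smul, inv_mul_cancel₀ ht]

theorem ContDiffAt.snd_taylorCoeff_one {E F : Type*} [NormedAddCommGroup E] [NormedSpace ℝ E]
    [NormedAddCommGroup F] [NormedSpace ℝ F] {f : ℝ → E × F} {h : ℝ → F}
    (hf : ContDiffAt ℝ ∞ f 0) (he : ∀ᶠ ε in 𝓝 0, (f ε).2 = ε • h ε) (hh : ContinuousAt h 0) :
    (_root_.taylorCoeff 1 f).2 = h 0 := by
  have h1 : HasDerivAt (fun ε => (f ε).2) (deriv f 0).2 0 :=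
    (hf.differentiableAt (by simp)).hasDerivAt.snd
  have h3 := h1.unique ((hasDerivAt_smul_self hh).congr_of_eventuallyEq he)
  simpa [_root_.taylorCoeff] using h3

theorem ContDiffAt.deriv_param {P E : Type*} [NormedAddCommGroup P] [NormedSpace ℝ P]
    [NormedAddCommGroup E] [NormedSpace ℝ E] {G : P → ℝ → E} {p : P} {t : ℝ}
    (hG : ContDiffAt ℝ ∞ (fun x : P × ℝ => G x.1 x.2) (p, t)) :
    ContDiffAt ℝ ∞ (fun x : P × ℝ => deriv (G x.1) x.2) (p, t) := by
  have h1 : ContDiffAt ℝ ∞ (Function.uncurry fun (x : P × ℝ) (s : ℝ) => G x.1 s)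
      ((p, t), (p, t).2) :=
    ContDiffAt.comp (f := fun x : (P × ℝ) × ℝ => (x.1.1, x.2)) ((p, t), t) hG
      (by fun_prop)
  have h2 := (h1.fderiv (g := fun x : P × ℝ => x.2) (m := ∞) contDiffAt_snd (by simp)).clm_apply
    (contDiffAt_const (c := (1 : ℝ)))
  simpa using h2

end TruncatedSeries

/-! ### Reconstructed loops and the coordinate domain -/

theorem contDiff_reconstruct {c : ℝ → SlowSpace × FastSpace} (hc : IsSmoothCurve c) :
    ContDiff ℝ ∞ fun x : ℝ × ℝ × ℝ => reconstruct x.1 (c x.2.1) x.2.2 := by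
  obtain ⟨h1, h2, h3⟩ := hc
  have a1 : ContDiff ℝ ∞ fun x : ℝ × ℝ × ℝ => (c x.2.1).1 :=
    h1.comp (contDiff_fst.comp contDiff_snd)
  have a2 := h2.comp (contDiff_snd (𝕜 := ℝ) (E := ℝ) (F := ℝ × ℝ) (n := ∞))
  have a3 := h3.comp (contDiff_snd (𝕜 := ℝ) (E := ℝ) (F := ℝ × ℝ) (n := ∞))
  exact (((contDiff_snd.comp contDiff_snd).add a1.fst).add a2).prodMk
    (a1.snd.fst.add (contDiff_fst.smul a3))

/-- Constant curves specialise the smoothness results along curves to a single state. -/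
theorem isSmoothCurve_const (p : SlowSpace × FastSpace) : IsSmoothCurve fun _ => p :=
  ⟨contDiff_const, p.2.1.contDiff.comp contDiff_snd, p.2.2.contDiff.comp contDiff_snd⟩

theorem reconstruct_zero (p : SlowSpace × FastSpace) (θ : ℝ) :
    reconstruct 0 p θ = (θ + p.1.1 + p.2.1 θ, p.1.2.1) := by
  simp [reconstruct]

theorem reconstruct_add_two_pi (ε : ℝ) (p : SlowSpace × FastSpace) (θ : ℝ) :
    reconstruct ε p (θ + 2 * Real.pi) = reconstruct ε p θ + (2 * Real.pi, 0) := by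
  simp only [reconstruct, p.2.1.periodic θ, p.2.2.periodic θ]
  ext1
  · simp; ring
  · simp

namespace KruskalCoordinates

variable {B : E3 → E3} (K : KruskalCoordinates B)

/-- The domain of the coordinates `(ζ, ξ)`. -/
def fullDom : Set (ℝ × E5) := Set.univ ×ˢ K.dom

theorem isOpen_fullDom : IsOpen K.fullDom := isOpen_univ.prod K.isOpen_dom

variable {K}

theorem mem_fullDom {z : ℝ × E5} : z ∈ K.fullDom ↔ z.2 ∈ K.dom := by simp [fullDom]

theorem fullDom_mem_nhds {z : ℝ × E5} (hz : z ∈ K.fullDom) : K.fullDom ∈ nhds z :=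
  K.isOpen_fullDom.mem_nhds hz

theorem add_two_pi_mem_fullDom {z : ℝ × E5} (hz : z ∈ K.fullDom) :
    z + (2 * Real.pi, 0) ∈ K.fullDom := by
  simpa [mem_fullDom] using hz

theorem reconstruct_zero_mem {p : SlowSpace × FastSpace} (hp : p ∈ K.states) (θ : ℝ) :
    reconstruct 0 p θ ∈ K.fullDom := by
  rw [mem_fullDom, reconstruct_zero]
  exact hp

theorem contDiffAt_scaledField {z : ℝ × E5} (hz : z ∈ K.fullDom) (ε : ℝ) :
    ContDiffAt ℝ ∞ (fun x : ℝ × (ℝ × E5) => K.scaledField x.1 x.2) (ε, z) := by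
  have h1 : ContDiffAt ℝ ∞ K.Om1 z.2 :=
    K.Om1_smooth.contDiffAt (K.isOpen_dom.mem_nhds (mem_fullDom.1 hz))
  have h2 := K.Om0_smooth.contDiffAt (fullDom_mem_nhds hz)
  have h3 := K.U0_smooth.contDiffAt (fullDom_mem_nhds hz)
  exact ((ContDiffAt.comp (f := fun x : ℝ × (ℝ × E5) => x.2.2) (ε, z) h1 (by fun_prop)).add
    (contDiffAt_fst.mul (ContDiffAt.comp (ε, z) h2 contDiffAt_snd))).prodMk
    (contDiffAt_fst.smul (ContDiffAt.comp (ε, z) h3 contDiffAt_snd))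

theorem scaledField_add_two_pi {z : ℝ × E5} (hz : z ∈ K.fullDom) (ε : ℝ) :
    K.scaledField ε (z + (2 * Real.pi, 0)) = K.scaledField ε z := by
  obtain ⟨ζ, ξ⟩ := z
  have h := mem_fullDom.1 hz
  simp only [scaledField, Prod.mk_add_mk, add_zero, K.Om0_periodic ζ ξ h, K.U0_periodic ζ ξ h]

end KruskalCoordinates

/-! ### Smoothness and periodicity of the transformed generator -/

namespace AllOrdersTransformation

open Filter Topology KruskalCoordinates

variable {B : E3 → E3} {K : KruskalCoordinates B} (T : AllOrdersTransformation K)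

/-- The preimage of a loop under the truncated transformation. -/
def invLoop (n : ℕ) (ε : ℝ) (p : SlowSpace × FastSpace) (θ : ℝ) : ℝ × E5 :=
  truncSeries T.Psi n ε (reconstruct ε p θ)

/-- The transformed, rescaled loop space generator, with truncated series. -/
def truncGenerator (n : ℕ) (ε : ℝ) (p : SlowSpace × FastSpace) (θ : ℝ) : ℝ × E5 :=
  fderiv ℝ (truncSeries T.Phi n ε) (T.invLoop n ε p θ)
    (loopGenerator (K.scaledField ε) K.omegaC (T.invLoop n ε p) θ)

theorem contDiffAt_Phi {z : ℝ × E5} (hz : z ∈ K.fullDom) (k : ℕ) : ContDiffAt ℝ ∞ (T.Phi k) z :=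
  (T.Phi_smooth k).contDiffAt (fullDom_mem_nhds hz)

theorem contDiffAt_Psi {z : ℝ × E5} (hz : z ∈ K.fullDom) (k : ℕ) : ContDiffAt ℝ ∞ (T.Psi k) z :=
  (T.Psi_smooth k).contDiffAt (fullDom_mem_nhds hz)

theorem truncSeries_Phi_add_two_pi {z : ℝ × E5} (hz : z ∈ K.fullDom) (n : ℕ) (ε : ℝ) :
    truncSeries T.Phi n ε (z + (2 * Real.pi, 0)) =
      truncSeries T.Phi n ε z + (2 * Real.pi, 0) := by
  refine truncSeries_shift (T.Phi_zero z hz) (T.Phi_zero _ (add_two_pi_mem_fullDom hz))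
    (fun k hk => ?_) n ε
  rw [show z + (2 * Real.pi, (0 : E5)) = (z.1 + 2 * Real.pi, z.2) from by ext1 <;> simp]
  exact T.Phi_periodic k hk z.1 z.2 (mem_fullDom.1 hz)

theorem truncSeries_Psi_add_two_pi {z : ℝ × E5} (hz : z ∈ K.fullDom) (n : ℕ) (ε : ℝ) :
    truncSeries T.Psi n ε (z + (2 * Real.pi, 0)) =
      truncSeries T.Psi n ε z + (2 * Real.pi, 0) := by
  refine truncSeries_shift (T.Psi_zero z hz) (T.Psi_zero _ (add_two_pi_mem_fullDom hz))
    (fun k hk => ?_) n ε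
  rw [show z + (2 * Real.pi, (0 : E5)) = (z.1 + 2 * Real.pi, z.2) from by ext1 <;> simp]
  exact T.Psi_periodic k hk z.1 z.2 (mem_fullDom.1 hz)

theorem fderiv_truncSeries_Phi_add_two_pi {z : ℝ × E5} (hz : z ∈ K.fullDom) (n : ℕ) (ε : ℝ) :
    fderiv ℝ (truncSeries T.Phi n ε) (z + (2 * Real.pi, 0)) =
      fderiv ℝ (truncSeries T.Phi n ε) z := by
  rw [← fderiv_comp_add_right]
  have h : (fun x => truncSeries T.Phi n ε (x + (2 * Real.pi, 0))) =ᶠ[𝓝 z]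
      fun x => truncSeries T.Phi n ε x + (2 * Real.pi, 0) := by
    filter_upwards [fullDom_mem_nhds hz] with x hx
    exact T.truncSeries_Phi_add_two_pi hx n ε
  rw [h.fderiv_eq, fderiv_add_const]

theorem invLoop_zero {p : SlowSpace × FastSpace} (hp : p ∈ K.states) (n : ℕ) (θ : ℝ) :
    T.invLoop n 0 p θ = reconstruct 0 p θ := by
  rw [invLoop, truncSeries_zero_right, T.Psi_zero _ (reconstruct_zero_mem hp θ)]

theorem invLoop_zero_mem {p : SlowSpace × FastSpace} (hp : p ∈ K.states) (n : ℕ) (θ : ℝ) :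
    T.invLoop n 0 p θ ∈ K.fullDom := by
  rw [T.invLoop_zero hp]
  exact reconstruct_zero_mem hp θ

theorem omegaC_invLoop_zero {p : SlowSpace × FastSpace} (hp : p ∈ K.states) (n : ℕ) :
    K.omegaC (T.invLoop n 0 p) = K.Om1 p.1.2.1 := by
  simp only [omegaC, T.invLoop_zero hp, reconstruct_zero, loopMean_const]

section Smoothness

variable {c : ℝ → SlowSpace × FastSpace}

theorem contDiffAt_invLoop (hc : IsSmoothCurve c) (hs : ∀ s, c s ∈ K.states)
    (n : ℕ) (s θ : ℝ) :
    ContDiffAt ℝ ∞ (fun x : ℝ × ℝ × ℝ => T.invLoop n x.1 (c x.2.1) x.2.2) (0, s, θ) :=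
  ContDiffAt.comp (f := fun x : ℝ × ℝ × ℝ => (x.1, reconstruct x.1 (c x.2.1) x.2.2)) (0, s, θ)
    (contDiffAt_truncSeries (fun k => T.contDiffAt_Psi (reconstruct_zero_mem (hs s) θ) k) n 0)
    (contDiffAt_fst.prodMk (contDiff_reconstruct hc).contDiffAt)

/-- The frequency depends on the whole loop, so smoothness passes through the average over `θ`. At
`ε = 0` that average is `ξ̄`, which lies in the open set where `Om1` is smooth. -/
theorem contDiffAt_omegaC (hc : IsSmoothCurve c) (hs : ∀ s, c s ∈ K.states)
    (n : ℕ) (s : ℝ) :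
    ContDiffAt ℝ ∞ (fun x : ℝ × ℝ => K.omegaC (T.invLoop n x.1 (c x.2))) (0, s) := by
  have h1 : ContDiffAt ℝ ∞ (fun x : ℝ × ℝ =>
      loopMean fun t => (T.invLoop n x.1 (c x.2) t).2) (0, s) :=
    contDiffAt_loopMean fun t =>
      ContDiffAt.comp (f := fun x : (ℝ × ℝ) × ℝ => (x.1.1, x.1.2, x.2)) ((0, s), t)
        (T.contDiffAt_invLoop hc hs n s t).snd (by fun_prop)
  refine ContDiffAt.comp (g := K.Om1) (0, s) ?_ h1
  refine K.Om1_smooth.contDiffAt (K.isOpen_dom.mem_nhds ?_)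
  simp only [T.invLoop_zero (hs s), reconstruct_zero, loopMean_const]
  exact hs s

theorem contDiffAt_loopGenerator (hc : IsSmoothCurve c) (hs : ∀ s, c s ∈ K.states)
    (n : ℕ) (s θ : ℝ) :
    ContDiffAt ℝ ∞ (fun x : ℝ × ℝ × ℝ => loopGenerator (K.scaledField x.1) K.omegaC
      (T.invLoop n x.1 (c x.2.1)) x.2.2) (0, s, θ) := by
  have h1 := T.contDiffAt_invLoop hc hs n s θ
  have h2 : ContDiffAt ℝ ∞ (fun x : ℝ × ℝ × ℝ =>
      K.scaledField x.1 (T.invLoop n x.1 (c x.2.1) x.2.2)) (0, s, θ) :=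
    ContDiffAt.comp (f := fun x : ℝ × ℝ × ℝ => (x.1, T.invLoop n x.1 (c x.2.1) x.2.2)) (0, s, θ)
      (contDiffAt_scaledField (T.invLoop_zero_mem (hs s) n θ) 0) (contDiffAt_fst.prodMk h1)
  have h3 : ContDiffAt ℝ ∞ (fun x : ℝ × ℝ × ℝ => K.omegaC (T.invLoop n x.1 (c x.2.1)))
      (0, s, θ) :=
    ContDiffAt.comp (f := fun x : ℝ × ℝ × ℝ => (x.1, x.2.1)) (0, s, θ)
      (T.contDiffAt_omegaC hc hs n s) (by fun_prop)
  have h4 : ContDiffAt ℝ ∞ (fun x : (ℝ × ℝ) × ℝ => T.invLoop n x.1.1 (c x.1.2) x.2)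
      ((0, s), θ) :=
    ContDiffAt.comp (f := fun x : (ℝ × ℝ) × ℝ => (x.1.1, x.1.2, x.2)) ((0, s), θ) h1
      (by fun_prop)
  have h5 := ContDiffAt.deriv_param (G := fun (x : ℝ × ℝ) t => T.invLoop n x.1 (c x.2) t) h4
  have h6 : ContDiffAt ℝ ∞ (fun x : ℝ × ℝ × ℝ => deriv (T.invLoop n x.1 (c x.2.1)) x.2.2)
      (0, s, θ) :=
    ContDiffAt.comp (f := fun x : ℝ × ℝ × ℝ => ((x.1, x.2.1), x.2.2)) (0, s, θ) h5 (by fun_prop)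
  exact h2.sub (h3.smul h6)

theorem contDiffAt_truncGenerator (hc : IsSmoothCurve c) (hs : ∀ s, c s ∈ K.states)
    (n : ℕ) (s θ : ℝ) :
    ContDiffAt ℝ ∞ (fun x : ℝ × ℝ × ℝ => T.truncGenerator n x.1 (c x.2.1) x.2.2) (0, s, θ) := by
  have h1 := T.contDiffAt_invLoop hc hs n s θ
  have h2 : ContDiffAt ℝ ∞ (Function.uncurry fun (x : ℝ × ℝ × ℝ) z => truncSeries T.Phi n x.1 z)
      ((0, s, θ), T.invLoop n 0 (c s) θ) :=
    ContDiffAt.comp (f := fun y : (ℝ × ℝ × ℝ) × (ℝ × E5) => (y.1.1, y.2))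
      ((0, s, θ), T.invLoop n 0 (c s) θ)
      (contDiffAt_truncSeries (fun k => T.contDiffAt_Phi (T.invLoop_zero_mem (hs s) n θ) k) n 0)
      (by fun_prop)
  exact (ContDiffAt.fderiv (m := ∞) h2 h1 (by simp)).clm_apply
    (T.contDiffAt_loopGenerator hc hs n s θ)

theorem contDiff_loopCoeff (hc : IsSmoothCurve c) (hs : ∀ s, c s ∈ K.states)
    (n : ℕ) :
    ContDiff ℝ ∞ fun x : ℝ × ℝ => T.loopCoeff n (c x.1) x.2 :=
  contDiff_iff_contDiffAt.2 fun x =>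
    (T.contDiffAt_truncGenerator hc hs n x.1 x.2).taylorCoeff
      (G := fun ε (x : ℝ × ℝ) => T.truncGenerator n ε (c x.1) x.2) n

theorem contDiff_phaseCoeff (hc : IsSmoothCurve c) (hs : ∀ s, c s ∈ K.states)
    (n : ℕ) : ContDiff ℝ ∞ fun s => T.phaseCoeff n (c s) :=
  contDiff_iff_contDiffAt.2 fun s =>
    (T.contDiffAt_omegaC hc hs n s).taylorCoeff
      (G := fun ε s => K.omegaC (T.invLoop n ε (c s))) n

theorem contDiff_loopMean_loopCoeff (hc : IsSmoothCurve c) (hs : ∀ s, c s ∈ K.states)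
    (n : ℕ) :
    ContDiff ℝ ∞ (fun s => loopMean fun θ => (T.loopCoeff n (c s) θ).1) ∧
      ContDiff ℝ ∞ fun s => loopMean fun θ => (T.loopCoeff n (c s) θ).2 :=
  ⟨contDiff_iff_contDiffAt.2 fun _ => contDiffAt_loopMean fun _ =>
    (T.contDiff_loopCoeff hc hs n).fst.contDiffAt,
  contDiff_iff_contDiffAt.2 fun _ => contDiffAt_loopMean fun _ =>
    (T.contDiff_loopCoeff hc hs n).snd.contDiffAt⟩

end Smoothness

variable {p : SlowSpace × FastSpace}

/-- For fixed `ε ≠ 0` the loop may leave the domain, but Taylor coefficients see only small `ε`. The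
inner neighbourhood of `θ` is what allows differentiation along the loop. -/
theorem eventually_reconstruct_mem (hp : p ∈ K.states) (θ : ℝ) :
    ∀ᶠ ε in 𝓝 (0 : ℝ), ∀ᶠ t in 𝓝 θ, reconstruct ε p t ∈ K.fullDom := by
  have h1 : ContinuousAt (fun x : ℝ × ℝ => reconstruct x.1 p x.2) (0, θ) :=
    ContinuousAt.comp (f := fun x : ℝ × ℝ => (x.1, (0 : ℝ), x.2))
      (contDiff_reconstruct (isSmoothCurve_const p)).continuous.continuousAt (by fun_prop)
  have h2 := h1.eventually (fullDom_mem_nhds (reconstruct_zero_mem hp θ))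
  exact h2.curry_nhds

theorem eventually_invLoop_mem (hp : p ∈ K.states) (n : ℕ) (θ : ℝ) :
    ∀ᶠ ε in 𝓝 (0 : ℝ), T.invLoop n ε p θ ∈ K.fullDom := by
  have h1 : ContinuousAt (fun ε => T.invLoop n ε p θ) 0 :=
    ContinuousAt.comp (f := fun ε : ℝ => (ε, (0 : ℝ), θ))
      (T.contDiffAt_invLoop (isSmoothCurve_const p) (fun _ => hp) n 0 θ).continuousAt
      (by fun_prop)
  exact h1.eventually (fullDom_mem_nhds (T.invLoop_zero_mem hp n θ))

/-- Advancing `θ` by `2π` translates the pulled-back loop by `(2π, 0)`, which changes neither its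
derivative, nor the field, nor `DΦ`. This holds for small `ε`, which determines the coefficient. -/
theorem loopCoeff_periodic (hp : p ∈ K.states) (n : ℕ) :
    Function.Periodic (T.loopCoeff n p) (2 * Real.pi) := fun θ => by
  refine EventuallyEq.taylorCoeff_eq (f := fun ε => T.truncGenerator n ε p (θ + 2 * Real.pi))
    (g := fun ε => T.truncGenerator n ε p θ) ?_ n
  filter_upwards [eventually_reconstruct_mem hp θ, T.eventually_invLoop_mem hp n θ]
    with ε h1 h2
  have h3 : (fun t => T.invLoop n ε p (t + 2 * Real.pi)) =ᶠ[𝓝 θ]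
      fun t => T.invLoop n ε p t + (2 * Real.pi, 0) := by
    filter_upwards [h1] with t ht
    rw [invLoop, reconstruct_add_two_pi, T.truncSeries_Psi_add_two_pi ht, invLoop]
  have h4 : deriv (T.invLoop n ε p) (θ + 2 * Real.pi) = deriv (T.invLoop n ε p) θ := by
    rw [← deriv_comp_add_const, h3.deriv_eq, deriv_add_const]
  have h5 : T.invLoop n ε p (θ + 2 * Real.pi) = T.invLoop n ε p θ + (2 * Real.pi, 0) :=
    h3.self_of_nhds
  simp only [truncGenerator, loopGenerator, h4, h5, scaledField_add_two_pi h2,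
    T.fderiv_truncSeries_Phi_add_two_pi h2]

end AllOrdersTransformation

/-! ### The coefficients of order zero and one -/

open Filter Topology in
theorem taylorCoeff_one_of_eventuallyEq {E : Type*} [NormedAddCommGroup E] [NormedSpace ℝ E]
    {f h : ℝ → E} {a : E} (he : ∀ᶠ ε in 𝓝 0, f ε = a + ε • h ε) (hh : ContinuousAt h 0) :
    taylorCoeff 1 f = h 0 := by
  have h3 := (((hasDerivAt_smul_self hh).const_add a).congr_of_eventuallyEq he).deriv
  simpa [taylorCoeff] using h3

theorem taylorCoeff_zero {E : Type*} [NormedAddCommGroup E] [NormedSpace ℝ E] (f : ℝ → E) :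
    taylorCoeff 0 f = f 0 := by
  simp [taylorCoeff]

theorem hasDerivAt_reconstruct (ε : ℝ) (p : SlowSpace × FastSpace) (θ : ℝ) :
    HasDerivAt (reconstruct ε p) (1 + p.2.1.dTheta θ, ε • p.2.2.dTheta θ) θ := by
  have h1 : HasDerivAt p.2.1 (p.2.1.dTheta θ) θ :=
    (p.2.1.contDiff.differentiable (by simp) θ).hasDerivAt
  have h2 : HasDerivAt p.2.2 (p.2.2.dTheta θ) θ :=
    (p.2.2.contDiff.differentiable (by simp) θ).hasDerivAt
  exact (((hasDerivAt_id θ).add_const _).add h1).prodMk ((h2.const_smul ε).const_add _)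

namespace AllOrdersTransformation

open Filter Topology KruskalCoordinates

variable {B : E3 → E3} {K : KruskalCoordinates B} (T : AllOrdersTransformation K)
variable {z : ℝ × E5} {p : SlowSpace × FastSpace}

theorem fderiv_truncSeries_Phi_one (hz : z ∈ K.fullDom) (ε : ℝ) (v : ℝ × E5) :
    fderiv ℝ (truncSeries T.Phi 1 ε) z v = v + ε • fderiv ℝ (T.Phi 1) z v := by
  have h : truncSeries T.Phi 1 ε =ᶠ[𝓝 z] fun x => x + ε • T.Phi 1 x := by
    filter_upwards [fullDom_mem_nhds hz] with x hx
    rw [truncSeries_one, T.Phi_zero x hx]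
  have h1 := ((T.contDiffAt_Phi hz 1).differentiableAt (by simp)).hasFDerivAt
  have h2 : HasFDerivAt (fun x => x + ε • T.Phi 1 x)
      (ContinuousLinearMap.id ℝ _ + ε • fderiv ℝ (T.Phi 1) z) z :=
    (hasFDerivAt_id z).add (h1.const_smul ε)
  rw [h.fderiv_eq, h2.fderiv]
  rfl

theorem fderiv_truncSeries_Phi_zero (hz : z ∈ K.fullDom) (n : ℕ) (v : ℝ × E5) :
    fderiv ℝ (truncSeries T.Phi n 0) z v = v := by
  have h : truncSeries T.Phi n 0 =ᶠ[𝓝 z] fun x => x := by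
    filter_upwards [fullDom_mem_nhds hz] with x hx
    rw [truncSeries_zero_right, T.Phi_zero x hx]
  rw [h.fderiv_eq, fderiv_fun_id]
  rfl

/-- The field contributes `Ω₋₁(ξ̄)` in the angle and the frequency term subtracts `Ω₋₁(ξ̄) (1 + ∂_θ
ν̂)`: the rotation cancels. -/
theorem loopGenerator_invLoop_zero (hp : p ∈ K.states) (n : ℕ) (θ : ℝ) :
    loopGenerator (K.scaledField 0) K.omegaC (T.invLoop n 0 p) θ =
      (-K.Om1 p.1.2.1 * p.2.1.dTheta θ, 0) := by
  have h : T.invLoop n 0 p = reconstruct 0 p := funext fun t => T.invLoop_zero hp n t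
  rw [loopGenerator, T.omegaC_invLoop_zero hp, h, (hasDerivAt_reconstruct 0 p θ).deriv,
    scaledField, reconstruct_zero]
  ext1
  · simp; ring
  · simp

theorem truncGenerator_zero (hp : p ∈ K.states) (n : ℕ) (θ : ℝ) :
    T.truncGenerator n 0 p θ = (-K.Om1 p.1.2.1 * p.2.1.dTheta θ, 0) := by
  rw [truncGenerator, T.fderiv_truncSeries_Phi_zero (T.invLoop_zero_mem hp n θ),
    T.loopGenerator_invLoop_zero hp]

theorem loopCoeff_zero (hp : p ∈ K.states) (θ : ℝ) :
    T.loopCoeff 0 p θ = (-K.Om1 p.1.2.1 * p.2.1.dTheta θ, 0) :=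
  (taylorCoeff_zero _).trans (T.truncGenerator_zero hp 0 θ)

theorem Psi_one (hz : z ∈ K.fullDom) : T.Psi 1 z = -T.Phi 1 z := by
  have h1 := T.Phi_Psi 1 z hz
  have hc : ContinuousAt (fun ε : ℝ => z + ε • T.Psi 1 z) 0 := by fun_prop
  have hm : ∀ᶠ ε in 𝓝 (0 : ℝ), z + ε • T.Psi 1 z ∈ K.fullDom :=
    hc.eventually (fullDom_mem_nhds (by simpa using hz))
  rw [taylorCoeff_one_of_eventuallyEq (a := z)
    (h := fun ε => T.Psi 1 z + T.Phi 1 (z + ε • T.Psi 1 z))] at h1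
  · simpa using eq_neg_of_add_eq_zero_left (by simpa using h1)
  · filter_upwards [hm] with ε hε
    rw [truncSeries_one T.Psi, T.Psi_zero z hz, truncSeries_one, T.Phi_zero _ hε, smul_add,
      add_assoc]
  · refine continuousAt_const.add (ContinuousAt.comp (g := T.Phi 1) ?_ hc)
    exact (T.contDiffAt_Phi (by simpa using hz) 1).continuousAt

/-- The homological equation of averaging: the `ξ`-component of the decoupling identity at order
one, where both sides carry an explicit factor `ε`. -/
theorem U0_add_fderiv_Phi_one (hz : z ∈ K.fullDom) :
    K.U0 z + (fderiv ℝ (T.Phi 1) z (K.Om1 z.2, 0)).2 = T.UBar 0 z.2 := by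
  have h := congrArg Prod.snd (T.decoupled 1 z hz)
  have hX : ContDiffAt ℝ ∞ (fun ε => K.scaledField ε z) 0 :=
    ContDiffAt.comp (f := fun ε : ℝ => (ε, z)) 0 (contDiffAt_scaledField hz 0) (by fun_prop)
  have hP : ContDiffAt ℝ ∞ (fun ε => truncSeries T.Phi 1 ε z) 0 :=
    ContDiffAt.comp (f := fun ε : ℝ => (ε, z)) 0
      (contDiffAt_truncSeries (fun k => T.contDiffAt_Phi hz k) 1 0) (by fun_prop)
  have hz0 : (truncSeries T.Phi 1 0 z).2 = z.2 := by
    rw [truncSeries_zero_right, T.Phi_zero z hz]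
  have hd : K.dom ∈ 𝓝 (truncSeries T.Phi 1 0 z).2 := by
    rw [hz0]
    exact K.isOpen_dom.mem_nhds (mem_fullDom.1 hz)
  have hO : ContDiffAt ℝ ∞ (fun ε => K.Om1 (truncSeries T.Phi 1 ε z).2) 0 :=
    ContDiffAt.comp (g := K.Om1) 0 (K.Om1_smooth.contDiffAt hd) hP.snd
  have hB : ContDiffAt ℝ ∞ (fun ε => truncSeries T.OmBar 1 ε (truncSeries T.Phi 1 ε z).2) 0 :=
    ContDiffAt.comp (f := fun ε : ℝ => (ε, (truncSeries T.Phi 1 ε z).2)) 0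
      (contDiffAt_truncSeries (fun k => (T.OmBar_smooth k).contDiffAt hd) 1 0)
      (contDiffAt_id.prodMk hP.snd)
  have hU : ContDiffAt ℝ ∞ (fun ε => truncSeries T.UBar 1 ε (truncSeries T.Phi 1 ε z).2) 0 :=
    ContDiffAt.comp (f := fun ε : ℝ => (ε, (truncSeries T.Phi 1 ε z).2)) 0
      (contDiffAt_truncSeries (fun k => (T.UBar_smooth k).contDiffAt hd) 1 0)
      (contDiffAt_id.prodMk hP.snd)
  have hD : ContDiffAt ℝ ∞ (fun ε => fderiv ℝ (T.Phi 1) z (K.scaledField ε z)) 0 :=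
    contDiffAt_const.clm_apply hX
  have hR : ContDiffAt ℝ ∞ (fun ε =>
      ((K.Om1 (truncSeries T.Phi 1 ε z).2 + ε * truncSeries T.OmBar 1 ε (truncSeries T.Phi 1 ε z).2,
        ε • truncSeries T.UBar 1 ε (truncSeries T.Phi 1 ε z).2) : ℝ × E5)) 0 :=
    (hO.add (contDiffAt_id.mul hB)).prodMk (contDiffAt_id.smul hU)
  rw [ContDiffAt.snd_taylorCoeff_one
      (h := fun ε => K.U0 z + (fderiv ℝ (T.Phi 1) z (K.scaledField ε z)).2),
    ContDiffAt.snd_taylorCoeff_one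
      (h := fun ε => truncSeries T.UBar 1 ε (truncSeries T.Phi 1 ε z).2)
      hR (Eventually.of_forall fun _ => rfl) hU.continuousAt,
    truncSeries_zero_right, hz0] at h
  · simpa [scaledField] using h
  · simp only [T.fderiv_truncSeries_Phi_one hz]
    exact hX.add (contDiffAt_id.smul hD)
  · refine Eventually.of_forall fun ε => ?_
    simp only [T.fderiv_truncSeries_Phi_one hz, scaledField, Prod.snd_add, Prod.smul_snd, smul_add]
  · exact continuousAt_const.add hD.snd.continuousAt

theorem deriv_invLoop_one (hp : p ∈ K.states) (θ : ℝ) :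
    ∀ᶠ ε in 𝓝 (0 : ℝ), deriv (T.invLoop 1 ε p) θ =
      (1 + p.2.1.dTheta θ, ε • p.2.2.dTheta θ) + ε • fderiv ℝ (T.Psi 1) (reconstruct ε p θ)
        (1 + p.2.1.dTheta θ, ε • p.2.2.dTheta θ) := by
  filter_upwards [eventually_reconstruct_mem hp θ] with ε hε
  have h1 : T.invLoop 1 ε p =ᶠ[𝓝 θ] fun t => reconstruct ε p t + ε • T.Psi 1 (reconstruct ε p t) := by
    filter_upwards [hε] with t ht
    rw [invLoop, truncSeries_one, T.Psi_zero _ ht]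
  have h2 := ((T.contDiffAt_Psi hε.self_of_nhds 1).differentiableAt (by simp)).hasFDerivAt
  have h3 := hasDerivAt_reconstruct ε p θ
  rw [h1.deriv_eq]
  exact (h3.add ((h2.comp_hasDerivAt θ h3).const_smul ε)).deriv

/-- The `ξ`-component of the generator is `ε` times an expression continuous at `ε = 0`, so the
coefficient is the value of that expression there. Three sources of `DΦ₁` terms (the pulled-back
loop's derivative, the push-forward, and the homological equation) then cancel. -/
theorem loopCoeff_one_snd (hp : p ∈ K.states) (θ : ℝ) :
    (T.loopCoeff 1 p θ).2 = T.UBar 0 p.1.2.1 - K.Om1 p.1.2.1 • p.2.2.dTheta θ := by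
  have hc := isSmoothCurve_const p
  have hs : ∀ _ : ℝ, p ∈ K.states := fun _ => hp
  have hι : ContDiffAt ℝ ∞ (fun ε : ℝ => (ε, (0 : ℝ), θ)) 0 := by fun_prop
  have hG : ContDiffAt ℝ ∞ (fun ε => T.truncGenerator 1 ε p θ) 0 :=
    ContDiffAt.comp (f := fun ε : ℝ => (ε, (0 : ℝ), θ)) 0
      (T.contDiffAt_truncGenerator hc hs 1 0 θ) hι
  have hw : ContDiffAt ℝ ∞ (fun ε => T.invLoop 1 ε p θ) 0 :=
    ContDiffAt.comp (f := fun ε : ℝ => (ε, (0 : ℝ), θ)) 0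
      (T.contDiffAt_invLoop hc hs 1 0 θ) hι
  have hV : ContDiffAt ℝ ∞
      (fun ε => loopGenerator (K.scaledField ε) K.omegaC (T.invLoop 1 ε p) θ) 0 :=
    ContDiffAt.comp (f := fun ε : ℝ => (ε, (0 : ℝ), θ)) 0
      (T.contDiffAt_loopGenerator hc hs 1 0 θ) hι
  have hω : ContDiffAt ℝ ∞ (fun ε => K.omegaC (T.invLoop 1 ε p)) 0 :=
    ContDiffAt.comp (f := fun ε : ℝ => (ε, (0 : ℝ))) 0
      (T.contDiffAt_omegaC hc hs 1 0) (by fun_prop)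
  have hr : ContDiffAt ℝ ∞ (fun ε => reconstruct ε p θ) 0 :=
    ContDiffAt.comp (f := fun ε : ℝ => (ε, (0 : ℝ), θ)) 0
      (contDiff_reconstruct hc).contDiffAt hι
  have hw0 := T.invLoop_zero_mem hp 1 θ
  have hr0 := reconstruct_zero_mem hp θ
  have hU : ContDiffAt ℝ ∞ (fun ε => K.U0 (T.invLoop 1 ε p θ)) 0 :=
    ContDiffAt.comp (g := K.U0) 0 (K.U0_smooth.contDiffAt (fullDom_mem_nhds hw0)) hw
  have hDΦ : ContDiffAt ℝ ∞ (fun ε => fderiv ℝ (T.Phi 1) (T.invLoop 1 ε p θ)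
      (loopGenerator (K.scaledField ε) K.omegaC (T.invLoop 1 ε p) θ)) 0 :=
    (ContDiffAt.comp (g := fderiv ℝ (T.Phi 1)) 0
      ((T.contDiffAt_Phi hw0 1).fderiv_right (m := ∞) (by simp)) hw).clm_apply hV
  have hDΨ : ContDiffAt ℝ ∞ (fun ε : ℝ => fderiv ℝ (T.Psi 1) (reconstruct ε p θ)
      (1 + p.2.1.dTheta θ, ε • p.2.2.dTheta θ)) 0 :=
    (ContDiffAt.comp (g := fderiv ℝ (T.Psi 1)) 0
      ((T.contDiffAt_Psi hr0 1).fderiv_right (m := ∞) (by simp)) hr).clm_apply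
      (by fun_prop)
  have key : (T.loopCoeff 1 p θ).2 = K.U0 (T.invLoop 1 0 p θ) - K.omegaC (T.invLoop 1 0 p) •
      (p.2.2.dTheta θ + (fderiv ℝ (T.Psi 1) (reconstruct 0 p θ)
        (1 + p.2.1.dTheta θ, (0 : ℝ) • p.2.2.dTheta θ)).2) +
      (fderiv ℝ (T.Phi 1) (T.invLoop 1 0 p θ)
        (loopGenerator (K.scaledField 0) K.omegaC (T.invLoop 1 0 p) θ)).2 := by
    refine ContDiffAt.snd_taylorCoeff_one hG (h := fun ε => K.U0 (T.invLoop 1 ε p θ) -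
      K.omegaC (T.invLoop 1 ε p) • (p.2.2.dTheta θ + (fderiv ℝ (T.Psi 1) (reconstruct ε p θ)
        (1 + p.2.1.dTheta θ, ε • p.2.2.dTheta θ)).2) +
      (fderiv ℝ (T.Phi 1) (T.invLoop 1 ε p θ)
        (loopGenerator (K.scaledField ε) K.omegaC (T.invLoop 1 ε p) θ)).2) ?_
      ((hU.sub (hω.smul (contDiffAt_const.add hDΨ.snd))).add hDΦ.snd).continuousAt
    filter_upwards [T.eventually_invLoop_mem hp 1 θ, T.deriv_invLoop_one hp θ] with ε h1 h2
    change (T.truncGenerator 1 ε p θ).2 = _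
    rw [truncGenerator, T.fderiv_truncSeries_Phi_one h1]
    simp only [Prod.snd_add, Prod.smul_snd, smul_add]
    congr 1
    simp only [loopGenerator, h2, scaledField, Prod.snd_sub, Prod.smul_snd, Prod.snd_add, smul_sub,
      smul_add, smul_comm ε (K.omegaC _)]
  rw [key, T.loopGenerator_invLoop_zero hp, T.omegaC_invLoop_zero hp, T.invLoop_zero hp]
  have hΨ : fderiv ℝ (T.Psi 1) (reconstruct 0 p θ) = -fderiv ℝ (T.Phi 1) (reconstruct 0 p θ) := by
    have : T.Psi 1 =ᶠ[𝓝 (reconstruct 0 p θ)] fun x => -T.Phi 1 x := by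
      filter_upwards [fullDom_mem_nhds hr0] with x hx using T.Psi_one hx
    rw [this.fderiv_eq, fderiv_fun_neg]
  have hdec := T.U0_add_fderiv_Phi_one hr0
  have h2 : (reconstruct 0 p θ).2 = p.1.2.1 := by rw [reconstruct_zero]
  rw [h2] at hdec
  -- At `ε = 0` all vectors fed to `DΦ₁` are purely angular, so every such term is a multiple of
  -- `DΦ₁(1, 0)`.
  have hlin : ∀ a : ℝ, fderiv ℝ (T.Phi 1) (reconstruct 0 p θ) (a, 0) =
      a • fderiv ℝ (T.Phi 1) (reconstruct 0 p θ) (1, 0) := fun a => by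
    rw [← map_smul]
    simp
  rw [hlin] at hdec
  rw [← hdec, hΨ, zero_smul, neg_apply, hlin, hlin (-_ * _)]
  simp only [Prod.snd_neg, Prod.smul_snd]
  -- The multiples of `DΦ₁(1, 0)` are `Ω₋₁ (1 + ∂_θ ν̂)` from `-DΨ₁`, `-Ω₋₁ ∂_θ ν̂` from the
  -- push-forward, and `Ω₋₁` on the other side.
  module

end AllOrdersTransformation

/-! ### Assembling the fast–slow system -/

namespace AllOrdersTransformation

open KruskalCoordinates

variable {B : E3 → E3} {K : KruskalCoordinates B} (T : AllOrdersTransformation K)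
variable {p : SlowSpace × FastSpace}

theorem contDiff_loopCoeff_const (hp : p ∈ K.states) (n : ℕ) : ContDiff ℝ ∞ (T.loopCoeff n p) :=
  ContDiff.comp (g := fun x : ℝ × ℝ => T.loopCoeff n p x.2) (f := fun θ : ℝ => ((0 : ℝ), θ))
    (T.contDiff_loopCoeff (isSmoothCurve_const p) (fun _ => hp) n) (by fun_prop)

/-- The angular component of the coefficients of the loop space generator, as a loop. -/
def angleLoop (n : ℕ) (hp : p ∈ K.states) : SmoothLoop ℝ :=
  ⟨fun θ => (T.loopCoeff n p θ).1,
    (T.contDiff_loopCoeff_const hp n).fst,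
    fun θ => congrArg Prod.fst (T.loopCoeff_periodic hp n θ)⟩

/-- The non-angular component of the coefficients of the loop space generator, as a loop. -/
def xiLoop (n : ℕ) (hp : p ∈ K.states) : SmoothLoop E5 :=
  ⟨fun θ => (T.loopCoeff n p θ).2,
    (T.contDiff_loopCoeff_const hp n).snd,
    fun θ => congrArg Prod.snd (T.loopCoeff_periodic hp n θ)⟩

open Classical in
/-- The coefficients of `ε ẏ`. -/
def fastCoeff (n : ℕ) (p : SlowSpace × FastSpace) : FastSpace :=
  -- The `ξ`-index is one higher: the generator is scaled by `ε`, and `ε ∂_t ϱ̂` is the fluctuation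
  -- of the unscaled `ξ`-rate. Off `K.states` the coefficients need not be loops, hence the value
  -- `0`.
  if hp : p ∈ K.states then ((T.angleLoop n hp).fluct, (T.xiLoop (n + 1) hp).fluct) else 0

/-- The coefficients of `ẋ`. -/
def slowCoeff (n : ℕ) (p : SlowSpace × FastSpace) : SlowSpace :=
  (loopMean fun θ => (T.loopCoeff (n + 1) p θ).1, loopMean fun θ => (T.loopCoeff (n + 1) p θ).2,
    T.phaseCoeff n p)

theorem fastCoeff_fst_apply (hp : p ∈ K.states) (n : ℕ) (θ : ℝ) :
    (T.fastCoeff n p).1 θ = (T.loopCoeff n p θ).1 - loopMean fun θ => (T.loopCoeff n p θ).1 := by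
  rw [fastCoeff, dif_pos hp]
  rfl

theorem fastCoeff_snd_apply (hp : p ∈ K.states) (n : ℕ) (θ : ℝ) :
    (T.fastCoeff n p).2 θ =
      (T.loopCoeff (n + 1) p θ).2 - loopMean fun θ => (T.loopCoeff (n + 1) p θ).2 := by
  rw [fastCoeff, dif_pos hp]
  rfl

theorem loopMean_loopCoeff_zero_fst (hp : p ∈ K.states) :
    (loopMean fun θ => (T.loopCoeff 0 p θ).1) = 0 := by
  simp only [T.loopCoeff_zero hp, ← smul_eq_mul]
  rw [loopMean_smul, p.2.1.dTheta.loopMean_eq_zero, smul_zero]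

theorem loopMean_loopCoeff_zero_snd (hp : p ∈ K.states) :
    (loopMean fun θ => (T.loopCoeff 0 p θ).2) = 0 := by
  simp only [T.loopCoeff_zero hp, loopMean_const]

theorem loopMean_loopCoeff_one_snd (hp : p ∈ K.states) :
    (loopMean fun θ => (T.loopCoeff 1 p θ).2) = T.UBar 0 p.1.2.1 := by
  simp only [T.loopCoeff_one_snd hp, sub_eq_add_neg, ← neg_smul]
  rw [loopMean_add (g := fun θ => -K.Om1 p.1.2.1 • p.2.2.dTheta θ) continuous_const
    ((-K.Om1 p.1.2.1) • p.2.2.dTheta).contDiff.continuous, loopMean_const, loopMean_smul,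
    p.2.2.dTheta.loopMean_eq_zero, smul_zero, add_zero]

theorem fastCoeff_zero (hp : p ∈ K.states) :
    T.fastCoeff 0 p = (-K.Om1 p.1.2.1) • (p.2.1.dTheta, p.2.2.dTheta) := by
  refine Prod.ext (MeanZeroLoop.ext fun θ => ?_) (MeanZeroLoop.ext fun θ => ?_)
  · rw [T.fastCoeff_fst_apply hp, T.loopMean_loopCoeff_zero_fst hp, T.loopCoeff_zero hp, sub_zero]
    rfl
  · rw [T.fastCoeff_snd_apply hp, zero_add, T.loopMean_loopCoeff_one_snd hp,
      T.loopCoeff_one_snd hp, Prod.smul_snd, MeanZeroLoop.smul_apply, neg_smul, sub_sub_cancel_left]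

theorem slowRate_eq (hp : p ∈ K.states) (m : ℤ) :
    T.slowRate m p = laurent (fun n => T.slowCoeff n p) m := by
  rcases lt_trichotomy m (-1) with hm | rfl | hm
  · have h1 : ¬ 0 ≤ m + 1 := by omega
    have h2 : ¬ 0 ≤ m := by omega
    simp [slowRate, loopRate, laurent, h1, h2, loopMean_const]
  -- Order `ε⁻¹`, the only negative power that could survive: both averages of the zeroth
  -- coefficient vanish.
  · simp [slowRate, loopRate, laurent, T.loopMean_loopCoeff_zero_fst hp,
      T.loopMean_loopCoeff_zero_snd hp]
  · obtain ⟨n, rfl⟩ := Int.eq_ofNat_of_zero_le (show 0 ≤ m by omega)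
    have h1 : (0 : ℤ) ≤ n + 1 := by omega
    have h2 : ((n : ℤ) + 1).toNat = n + 1 := by omega
    simp [slowRate, loopRate, laurent, slowCoeff, h1, h2]

theorem fastRate_eq (hp : p ∈ K.states) (m : ℤ) :
    T.fastRate m p =
      laurent (fun n => (((T.fastCoeff n p).1 : ℝ → ℝ), ((T.fastCoeff n p).2 : ℝ → E5)))
        (m + 1) := by
  have hz : ∀ {E : Type} [NormedAddCommGroup E] [NormedSpace ℝ E] [CompleteSpace E],
      loopFluct (fun _ => (0 : E)) = 0 := fun {E} _ _ _ => funext fun θ => by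
    simp [loopFluct, loopMean_const]
  rcases lt_trichotomy m (-2) with hm | rfl | hm
  · have h1 : ¬ 0 ≤ m + 1 := by omega
    have h2 : ¬ 0 ≤ m + 1 + 1 := by omega
    simp [fastRate, loopRate, laurent, h1, h2, hz]
  -- Order `ε⁻²` of `ẏ`, possible only through the factor `ε⁻¹` in `ϱ̂`; it is absent because the
  -- zeroth `ξ`-coefficient is zero.
  · simp [fastRate, loopRate, laurent, T.loopCoeff_zero hp, hz]
  · obtain ⟨n, hn⟩ := Int.eq_ofNat_of_zero_le (show 0 ≤ m + 1 by omega)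
    have h1 : (0 : ℤ) ≤ n + 1 := by omega
    have h2 : ((n : ℤ) + 1).toNat = n + 1 := by omega
    rw [fastRate, loopRate, loopRate, hn]
    refine Prod.ext (funext fun θ => ?_) (funext fun θ => ?_)
    · simp [laurent, T.fastCoeff_fst_apply hp, loopFluct]
    · simp [laurent, T.fastCoeff_snd_apply hp, loopFluct, h1, h2]

theorem isSmoothCurve_coeff {c : ℝ → SlowSpace × FastSpace} (hc : IsSmoothCurve c)
    (hs : ∀ s, c s ∈ K.states) (n : ℕ) :
    IsSmoothCurve fun s => (T.slowCoeff n (c s), T.fastCoeff n (c s)) := by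
  have h1 := T.contDiff_loopCoeff hc hs n
  have h2 := T.contDiff_loopCoeff hc hs (n + 1)
  have m1 := T.contDiff_loopMean_loopCoeff hc hs n
  have m2 := T.contDiff_loopMean_loopCoeff hc hs (n + 1)
  refine ⟨m2.1.prodMk (m2.2.prodMk (T.contDiff_phaseCoeff hc hs n)), ?_, ?_⟩
  · simp only [T.fastCoeff_fst_apply (hs _)]
    exact h1.fst.sub (m1.1.comp contDiff_fst)
  · simp only [T.fastCoeff_snd_apply (hs _)]
    exact h2.snd.sub (m2.2.comp contDiff_fst)

/-- The factor `Ω₋₁(ξ̄)` depends on `x` only, so at fixed `x` the leading term is a linear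
isomorphism and equals its own derivative at every `y`. -/
theorem exists_hasDerivativeAt_fastCoeff_zero (hp : p ∈ K.states) :
    ∃ L : FastSpace ≃L[ℝ] FastSpace,
      (∀ h : FastSpace, L h = (-K.Om1 p.1.2.1) • (h.1.dTheta, h.2.dTheta)) ∧
      HasDerivativeAt (fun y => T.fastCoeff 0 (p.1, y)) (L : FastSpace →L[ℝ] FastSpace) p.2 := by
  have hne : -K.Om1 p.1.2.1 ≠ 0 := neg_ne_zero.2 (K.Om1_ne_zero _ hp)
  refine ⟨(MeanZeroLoop.smulDThetaEquiv _ hne).prodCongr (MeanZeroLoop.smulDThetaEquiv _ hne),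
    fun _ => rfl, hasDerivativeAt_of_linear _ (fun y => ?_) _⟩
  exact T.fastCoeff_zero (p := (p.1, y)) hp

end AllOrdersTransformation

end

theorem proposition2 (B : E3 → E3) (hB : ContDiff ℝ ∞ B) (K : KruskalCoordinates B)
    (T : AllOrdersTransformation K) :
    (∀ ε : ℝ, ε ≠ 0 → Function.Bijective (splitting ε) ∧
      ∀ (ν : SmoothLoop ℝ) (ξ : SmoothLoop E5) (S θ : ℝ),
        reconstruct ε (splitting ε (ν, ξ, S)) θ = (θ + ν θ, ξ θ)) ∧
    ∃ (f : ℕ → SlowSpace × FastSpace → FastSpace) (g : ℕ → SlowSpace × FastSpace → SlowSpace),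
      (∀ p ∈ K.states, ∀ m : ℤ, T.slowRate m p = laurent (fun n => g n p) m) ∧
      (∀ p ∈ K.states, ∀ m : ℤ,
        T.fastRate m p =
          laurent (fun n => (((f n p).1 : ℝ → ℝ), ((f n p).2 : ℝ → E5))) (m + 1)) ∧
      IsFormalFastSlow K.states f g ∧
      (∀ p ∈ K.states, f 0 p = (-K.Om1 p.1.2.1) • (p.2.1.dTheta, p.2.2.dTheta)) ∧
      (∀ p ∈ K.states, K.Om1 p.1.2.1 ≠ 0 ∧
        ∃ L : FastSpace ≃L[ℝ] FastSpace,
          (∀ h : FastSpace, L h = (-K.Om1 p.1.2.1) • (h.1.dTheta, h.2.dTheta)) ∧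
          HasDerivativeAt (fun y => f 0 (p.1, y)) (L : FastSpace →L[ℝ] FastSpace) p.2) := by
  refine ⟨fun ε hε => ⟨splitting_bijective hε, reconstruct_splitting hε⟩,
    T.fastCoeff, T.slowCoeff, fun p hp m => T.slowRate_eq hp m, fun p hp m => T.fastRate_eq hp m,
    ⟨fun n c hc hs => T.isSmoothCurve_coeff hc hs n, fun p hp _ => ?_⟩,
    fun p hp => T.fastCoeff_zero hp,
    fun p hp => ⟨K.Om1_ne_zero _ hp, T.exists_hasDerivativeAt_fastCoeff_zero hp⟩⟩
  obtain ⟨L, -, hL⟩ := T.exists_hasDerivativeAt_fastCoeff_zero hp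
  exact ⟨L, hL⟩
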